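/- Write $\lg=\log_2$ and $[n]=\{0,\dots,n-1\}$. The model is the unit-cost word RAM with words of $w=\Omega(\lg n)$ bits (in particular word length $\Theta(\lg n)$). Every arithmetic operation modulo $2^w$ (including multiplication and division with remainder), bitwise operation, shift, comparison with jump, copy, constant load or memory read costs one step. The data structure is a string of bits packed into consecutive $w$-bit memory words, which is only read during queries; addresses are single words, and each query program uses a fixed number of registers. (a) For every constant $a>1$ there are two fixed programs and a constant $C$ (depending only on $a$) such that the following holds for all integers $n,t,w$ with $1\le t\le\lg n$ and $w\ge a\lg n$. Every permutation $\pi$ of $[n]$ can be stored as a string of at most $$\lceil\lg n!\rceil + C\,\frac{n}{t}\lg n$$ bits such that, with this string in memory and given $n$, $w$, $t$ and a query $x\in[n]$ in registers, the first program outputs $\pi(x)$ within $C$ steps and the second outputs $\pi^{-1}(x)$ within $Ct$ steps. That is, the space is $\lceil\lg n!\rceil+O((n/t)\lg n)$ bits, $\pi()$ takes $O(1)$ time, and $\pi^{-1}()$ takes $O(t)$ time. (b) For all constants $a>1$ and $\varepsilon>0$ there are two fixed programs and a constant $C$ (depending only on $a$ and $\varepsilon$) such that, for all integers $n\ge 0$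 and $w\ge 1$ with $w\ge a\lg n$ (a condition that is void for $n=0$), every permutation $\pi$ of $[n]$ can be stored as a string of at most $(1+\varepsilon)\,n\lg n$ bits (read as $0$ for $n=0$) such that, with this string in memory and given $n$, $w$ and $x\in[n]$ in registers, the two programs output $\pi(x)$ and $\pi^{-1}(x)$, respectively, within $C$ steps each. -/

import Mathlib

open scoped Nat

/-! A unit-cost word RAM. Words are bit vectors of length `w`. The memory holds the data
structure, a string of `s` bits packed into consecutive words, and is only read during a query;
the working space of a query is the finitely many registers that occur in the program. -/

namespace WordRAM

/-- The arithmetic, bitwise and shift operations on words. -/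
inductive BinOp where
  | add | sub | mul | div | mod | land | lor | xor | shl | shr

/-- Unsigned arithmetic modulo `2 ^ w`, truncated division (with quotient `0` for divisor `0`),
bitwise operations, and logical shifts of the first word by the value of the second. -/
def BinOp.eval {w : ℕ} : BinOp → BitVec w → BitVec w → BitVec w
  | .add, x, y => x + y
  | .sub, x, y => x - y
  | .mul, x, y => x * y
  | .div, x, y => x / y
  | .mod, x, y => x % y
  | .land, x, y => x &&& y
  | .lor, x, y => x ||| y
  | .xor, x, y => x ^^^ y
  | .shl, x, y => x <<< y
  | .shr, x, y => x >>> y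

/-- Instructions. Arguments `d a b` are register numbers and `l` is a position in the program. -/
inductive Instr where
  /-- put the literal `c` (modulo `2 ^ w`) into register `d` -/
  | const (d c : ℕ)
  /-- copy register `a` to register `d` -/
  | copy (d a : ℕ)
  /-- apply a word operation to registers `a` and `b`, result in register `d` -/
  | op (o : BinOp) (d a b : ℕ)
  /-- read the memory word whose address is in register `a` into register `d` -/
  | load (d a : ℕ)
  /-- go to `l` -/
  | jump (l : ℕ)
  /-- go to `l` if registers `a` and `b` are equal -/
  | jumpEq (a b l : ℕ)
  /-- go to `l` if register `a` is less than register `b` as an unsigned number -/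
  | jumpLt (a b l : ℕ)

/-- A program is a finite list of instructions, numbered from `0`. -/
abbrev Program := List Instr

/-- A configuration: the position in the program and the contents of the registers. -/
structure Config (w : ℕ) where
  pc : ℕ
  reg : ℕ → BitVec w

/-- Memory word number `i`: the bits `i * w, …, i * w + w - 1` of the data structure `D`,
where positions beyond the end of `D` read as zero. -/
def memWord {s : ℕ} (w : ℕ) (D : BitVec s) (i : ℕ) : BitVec w :=
  D.extractLsb' (i * w) w

/-- The effect of one instruction. -/
def Instr.exec {w s : ℕ} (D : BitVec s) (c : Config w) : Instr → Config w
  | .const d v => ⟨c.pc + 1, Function.update c.reg d (BitVec.ofNat w v)⟩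
  | .copy d a => ⟨c.pc + 1, Function.update c.reg d (c.reg a)⟩
  | .op o d a b => ⟨c.pc + 1, Function.update c.reg d (o.eval (c.reg a) (c.reg b))⟩
  | .load d a => ⟨c.pc + 1, Function.update c.reg d (memWord w D (c.reg a).toNat)⟩
  | .jump l => ⟨l, c.reg⟩
  | .jumpEq a b l => ⟨if c.reg a = c.reg b then l else c.pc + 1, c.reg⟩
  | .jumpLt a b l => ⟨if (c.reg a).toNat < (c.reg b).toNat then l else c.pc + 1, c.reg⟩

/-- The machine halts when the position lies outside the program. -/
def Halted {w : ℕ} (P : Program) (c : Config w) : Prop := P[c.pc]? = none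

/-- One step: execute the current instruction; a halted configuration does not change. -/
def step {w s : ℕ} (P : Program) (D : BitVec s) (c : Config w) : Config w :=
  match P[c.pc]? with
  | none => c
  | some i => i.exec D c

/-- The initial configuration: the inputs in registers `0, 1, …`, and `0` in all others. -/
def init (w : ℕ) (inputs : List ℕ) : Config w :=
  ⟨0, fun r => BitVec.ofNat w (inputs.getD r 0)⟩

/-- On words of length `w`, with the data structure `D` in memory, the program `P` started on
`inputs` halts after at most `T` steps with the number `y` in register `0`. -/
def Computes {s : ℕ} (w : ℕ) (D : BitVec s) (P : Program) (inputs : List ℕ) (y T : ℕ) : Prop :=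
  ∃ k ≤ T, Halted P ((step P D)^[k] (init w inputs)) ∧
    (((step P D)^[k] (init w inputs)).reg 0).toNat = y

end WordRAM

/-! For large $n$ the images are stored as a plain array with fields of $\lg n+O(1)$ bits. This is
cheap enough: $n^n/n!\le e^n$ gives $n\lg n\le\lg n!+2n$, and $t\le\lg n$ gives $n\le(n/t)\lg n$, so
$O(n)$ extra bits disappear in the error term.

For the inverse, $O(n/t)$ elements are marked so that every forward walk of $t$ steps meets a mark
or closes its cycle (`exists_hitting_set`). Each marked $y$ has a shortcut to $\pi^{-t}(y)$. The
walk from $x$ either reaches the predecessor of $x$ directly, or stops at a marked $y=\pi^i(x)$ with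
$i<t$. In the latter case the shortcut leads to $\pi^{-(t-i)}(x)$, and $t-i-1$ further steps suffice
to reach $\pi^{-1}(x)$. The shortcut of $y$ is located by the rank of $y$ among the marked elements:
a directory gives the ranks at multiples of $t$, and fewer than $t$ mark bits remain to be counted.

The hypothesis $a>1$ makes a field shorter than a word and lets every bit position fit into a word.
The field width $B$ is not an input; a header is chosen so that the first memory word is congruent
to $B$ modulo $n$.

For $n$ below a constant, the number of the permutation is stored in $\lfloor n\lg n\rfloor$ bits,
which suffice because $2\,n!\le n^n$ for $n\ge2$; a decision tree with all answers in the program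
decodes it. In part (b), $t$ is a constant of order $1/\varepsilon$. -/

namespace WordRAM

/-! ### Structured programs and a total-correctness logic with step counts. -/

/-- The contents of the registers. -/
abbrev Regs (w : ℕ) := ℕ → BitVec w

/-- The instructions without jumps. -/
inductive Basic where
  | const (d c : ℕ)
  | copy (d a : ℕ)
  | op (o : BinOp) (d a b : ℕ)
  | load (d a : ℕ)

/-- A basic instruction as an instruction of the machine. -/
def Basic.toInstr : Basic → Instr
  | .const d c => .const d c
  | .copy d a => .copy d a
  | .op o d a b => .op o d a b
  | .load d a => .load d a

/-- The effect of a basic instruction on the registers. -/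
def Basic.exec {w s : ℕ} (D : BitVec s) (ρ : Regs w) : Basic → Regs w
  | .const d v => Function.update ρ d (BitVec.ofNat w v)
  | .copy d a => Function.update ρ d (ρ a)
  | .op o d a b => Function.update ρ d (o.eval (ρ a) (ρ b))
  | .load d a => Function.update ρ d (memWord w D (ρ a).toNat)

/-- Structured programs. -/
inductive Stmt where
  | block (l : List Basic)
  | seq (s₁ s₂ : Stmt)
  | ifEq (a b : ℕ) (s₁ s₂ : Stmt)
  | whileNe (a b : ℕ) (s : Stmt)

/-- The number of instructions of the compiled program. -/
def Stmt.len : Stmt → ℕ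
  | .block l => l.length
  | .seq s₁ s₂ => s₁.len + s₂.len
  | .ifEq _ _ s₁ s₂ => s₂.len + s₁.len + 2
  | .whileNe _ _ s => s.len + 2

/-- The compiled program, to be placed at position `base`. -/
def Stmt.compile : Stmt → ℕ → Program
  | .block l, _ => l.map Basic.toInstr
  | .seq s₁ s₂, base => s₁.compile base ++ s₂.compile (base + s₁.len)
  | .ifEq a b s₁ s₂, base =>
      .jumpEq a b (base + s₂.len + 2) ::
        (s₂.compile (base + 1) ++
          .jump (base + s₂.len + 2 + s₁.len) :: s₁.compile (base + s₂.len + 2))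
  | .whileNe a b s, base =>
      .jumpEq a b (base + s.len + 2) :: (s.compile (base + 1) ++ [.jump base])

theorem Stmt.length_compile (s : Stmt) (base : ℕ) : (s.compile base).length = s.len := by
  induction s generalizing base with
  | block l => simp [compile, len]
  | seq s₁ s₂ h₁ h₂ => simp [compile, len, h₁, h₂]
  | ifEq a b s₁ s₂ h₁ h₂ => simp [compile, len, h₁, h₂]; omega
  | whileNe a b s h => simp [compile, len, h]

/-- The program `Q` occurs in `P` at position `base`. -/
def Placed (Q P : Program) (base : ℕ) : Prop :=
  ∃ pre post, P = pre ++ Q ++ post ∧ pre.length = base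

theorem Placed.left {Q R P : Program} {base : ℕ} (h : Placed (Q ++ R) P base) :
    Placed Q P base := by
  obtain ⟨pre, post, rfl, rfl⟩ := h
  exact ⟨pre, R ++ post, by simp, rfl⟩

theorem Placed.right {Q R P : Program} {base : ℕ} (h : Placed (Q ++ R) P base) :
    Placed R P (base + Q.length) := by
  obtain ⟨pre, post, rfl, rfl⟩ := h
  exact ⟨pre ++ Q, post, by simp, by simp⟩

theorem Placed.tail {i : Instr} {R P : Program} {base : ℕ} (h : Placed (i :: R) P base) :
    Placed R P (base + 1) :=
  Placed.right (Q := [i]) h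

theorem Placed.head {i : Instr} {R P : Program} {base : ℕ} (h : Placed (i :: R) P base) :
    P[base]? = some i := by
  obtain ⟨pre, post, rfl, rfl⟩ := h
  simp

/-- Wherever `S` is placed, it runs from the registers `ρ` to its end in at most `k` steps,
and then the registers satisfy `Q`. -/
def Ev {s w : ℕ} (D : BitVec s) (S : Stmt) (ρ : Regs w) (k : ℕ) (Q : Regs w → Prop) : Prop :=
  ∀ P base, Placed (S.compile base) P base →
    ∃ k' ≤ k, ∃ ρ', (step P D)^[k'] ⟨base, ρ⟩ = ⟨base + S.len, ρ'⟩ ∧ Q ρ'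

variable {s w : ℕ} {D : BitVec s}

theorem Ev.mono {S : Stmt} {ρ : Regs w} {k k' : ℕ} {Q Q' : Regs w → Prop} (h : Ev D S ρ k Q)
    (hk : k ≤ k') (hQ : ∀ ρ', Q ρ' → Q' ρ') : Ev D S ρ k' Q' := by
  intro P base hP
  obtain ⟨j, hj, ρ', h1, h2⟩ := h P base hP
  exact ⟨j, hj.trans hk, ρ', h1, hQ _ h2⟩

theorem Ev.block {l : List Basic} {ρ : Regs w} {Q : Regs w → Prop}
    (h : Q (l.foldl (Basic.exec D) ρ)) : Ev D (.block l) ρ l.length Q := by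
  intro P base hP
  refine ⟨l.length, le_rfl, _, ?_, h⟩
  clear h
  simp only [Stmt.compile, Stmt.len] at *
  induction l generalizing base ρ with
  | nil => simp
  | cons i l ih =>
    have h1 := hP.head
    have h2 := ih (base + 1) (ρ := Basic.exec D ρ i) hP.tail
    have h3 : step P D ⟨base, ρ⟩ = ⟨base + 1, Basic.exec D ρ i⟩ := by
      simp only [step, h1]
      cases i <;> rfl
    rw [List.length_cons, Function.iterate_succ_apply, h3, h2]
    simp only [List.foldl_cons, Config.mk.injEq, and_true]
    omega

/-- The postcondition of the first part is the claim about the second, so a correctness proof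
follows the execution and no intermediate assertion has to be named. -/
theorem Ev.seq {S₁ S₂ : Stmt} {ρ : Regs w} {k₁ k₂ : ℕ} {Q : Regs w → Prop}
    (h : Ev D S₁ ρ k₁ fun ρ' => Ev D S₂ ρ' k₂ Q) : Ev D (.seq S₁ S₂) ρ (k₁ + k₂) Q := by
  intro P base hP
  obtain ⟨j₁, hj₁, ρ₁, e₁, h₁⟩ := h P base hP.left
  have hr := hP.right
  rw [Stmt.length_compile] at hr
  obtain ⟨j₂, hj₂, ρ₂, e₂, h₂⟩ := h₁ P _ hr
  refine ⟨j₂ + j₁, by omega, ρ₂, ?_, h₂⟩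
  rw [Function.iterate_add_apply, e₁, e₂]
  simp [Stmt.len, add_assoc]

theorem Ev.ifEq_pos {a b : ℕ} {S₁ S₂ : Stmt} {ρ : Regs w} {k : ℕ} {Q : Regs w → Prop}
    (hab : ρ a = ρ b) (h : Ev D S₁ ρ k Q) : Ev D (.ifEq a b S₁ S₂) ρ (k + 1) Q := by
  intro P base hP
  have h0 : step P D ⟨base, ρ⟩ = ⟨base + S₂.len + 2, ρ⟩ := by
    simp [step, Placed.head hP, Instr.exec, hab]
  have hr := (Placed.tail hP).right.tail
  rw [Stmt.length_compile, show base + 1 + S₂.len + 1 = base + S₂.len + 2 by ring] at hr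
  obtain ⟨j, hj, ρ', e, h'⟩ := h P _ hr
  refine ⟨j + 1, by omega, ρ', ?_, h'⟩
  rw [Function.iterate_succ_apply, h0, e]
  simp only [Stmt.len, Config.mk.injEq, and_true]
  omega

theorem Ev.ifEq_neg {a b : ℕ} {S₁ S₂ : Stmt} {ρ : Regs w} {k : ℕ} {Q : Regs w → Prop}
    (hab : ρ a ≠ ρ b) (h : Ev D S₂ ρ k Q) : Ev D (.ifEq a b S₁ S₂) ρ (k + 2) Q := by
  intro P base hP
  have h0 : step P D ⟨base, ρ⟩ = ⟨base + 1, ρ⟩ := by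
    simp [step, Placed.head hP, Instr.exec, hab]
  obtain ⟨j, hj, ρ', e, h'⟩ := h P _ (Placed.tail hP).left
  have h1 := (Placed.tail hP).right.head
  rw [Stmt.length_compile] at h1
  refine ⟨1 + (j + 1), by omega, ρ', ?_, h'⟩
  rw [Function.iterate_add_apply, Function.iterate_one, Function.iterate_succ_apply, h0, e]
  simp only [step, h1, Instr.exec, Stmt.len, Config.mk.injEq, and_true]
  omega

theorem Ev.ifEq {a b : ℕ} {S₁ S₂ : Stmt} {ρ : Regs w} {k : ℕ} {Q : Regs w → Prop}
    (h₁ : ρ a = ρ b → Ev D S₁ ρ k Q) (h₂ : ρ a ≠ ρ b → Ev D S₂ ρ k Q) :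
    Ev D (.ifEq a b S₁ S₂) ρ (k + 2) Q := by
  by_cases hab : ρ a = ρ b
  · exact (Ev.ifEq_pos hab (h₁ hab)).mono (by omega) fun _ h => h
  · exact Ev.ifEq_neg hab (h₂ hab)

/-- The loop rule: `I m` is an invariant that allows at most `m` more iterations. -/
theorem Ev.whileNe {a b : ℕ} {S : Stmt} {k : ℕ} {Q : Regs w → Prop} (I : ℕ → Regs w → Prop)
    (hbody : ∀ m ρ, I m ρ → ρ a ≠ ρ b → ∃ m', m = m' + 1 ∧ Ev D S ρ k (I m'))
    (hend : ∀ m ρ, I m ρ → ρ a = ρ b → Q ρ) {m : ℕ} {ρ : Regs w} (h : I m ρ) :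
    Ev D (.whileNe a b S) ρ (m * (k + 2) + 1) Q := by
  intro P base hP
  induction m using Nat.strong_induction_on generalizing ρ with
  | _ m ih =>
  by_cases hab : ρ a = ρ b
  · refine ⟨1, by omega, ρ, ?_, hend _ _ h hab⟩
    simp [step, Placed.head hP, Instr.exec, hab, Stmt.len, add_assoc]
  · obtain ⟨m', rfl, hb⟩ := hbody m ρ h hab
    have h0 : step P D ⟨base, ρ⟩ = ⟨base + 1, ρ⟩ := by
      simp [step, Placed.head hP, Instr.exec, hab]
    obtain ⟨j, hj, ρ', e, h'⟩ := hb P _ (Placed.tail hP).left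
    have h1 := (Placed.tail hP).right.head
    rw [Stmt.length_compile] at h1
    obtain ⟨i, hi, ρ'', e', h''⟩ := ih m' (by omega) h'
    refine ⟨i + (1 + (j + 1)), by nlinarith, ρ'', ?_, h''⟩
    rw [Function.iterate_add_apply, Function.iterate_add_apply _ 1, Function.iterate_one,
      Function.iterate_succ_apply, h0, e, ← e']
    simp [step, h1, Instr.exec]

/-- A structured program only ever leaves at its end, and the position just behind the last
instruction counts as halted. -/
theorem Ev.computes {S : Stmt} {inputs : List ℕ} {y k : ℕ}
    (h : Ev D S (init w inputs).reg k fun ρ => (ρ 0).toNat = y) :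
    Computes w D (S.compile 0) inputs y k := by
  obtain ⟨j, hj, ρ, e, hρ⟩ := h (S.compile 0) 0 ⟨[], [], by simp, rfl⟩
  refine ⟨j, hj, ?_⟩
  change Halted _ ((step _ D)^[j] ⟨0, (init w inputs).reg⟩) ∧
    ((((step _ D)^[j] ⟨0, (init w inputs).reg⟩)).reg 0).toNat = y
  rw [e]
  refine ⟨?_, hρ⟩
  simp [Halted, Stmt.length_compile]

end WordRAM

/-! ### Small $n$: decision trees over the bits of the memory. -/

namespace WordRAM

variable {s w : ℕ} {D : BitVec s}

/-- Compare register `r` with `i, …, i + m - 1` and branch to `f` at the value that is found,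
or to `dflt`. -/
def switch (r : ℕ) (f : ℕ → Stmt) (dflt : Stmt) : ℕ → ℕ → Stmt
  | _, 0 => dflt
  | i, m + 1 => .seq (.block [.const 9 i]) (.ifEq r 9 (f i) (switch r f dflt (i + 1) m))

/-- Literals are reduced modulo $2^w$, and $w$ may be tiny. The comparisons run upwards and stop at
$v<2^w$, so no literal that wraps around is ever compared. -/
theorem Ev.switch_of_lt {r : ℕ} {f : ℕ → Stmt} {dflt : Stmt} {ρ : Regs w} {k v : ℕ}
    {Q : Regs w → Prop} (hr : r ≠ 9) (hv : (ρ r).toNat = v) (i m : ℕ) (hi : i ≤ v)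
    (him : v < i + m) (h : ∀ ρ' : Regs w, (∀ q ≠ 9, ρ' q = ρ q) → Ev D (f v) ρ' k Q) :
    Ev D (switch r f dflt i m) ρ (k + 3 * m) Q := by
  induction m generalizing i ρ with
  | zero => omega
  | succ m ih =>
    have hvw : v < 2 ^ w := hv ▸ (ρ r).isLt
    refine (Ev.seq (k₂ := k + 3 * m + 2) (Ev.block ?_)).mono (by simp; omega) fun _ h => h
    simp only [List.foldl_cons, List.foldl_nil, Basic.exec]
    set ρ' := Function.update ρ 9 (BitVec.ofNat w i) with hρ'
    have hag : ∀ q ≠ 9, ρ' q = ρ q := fun q hq => by simp [hρ', hq]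
    have h9 : (ρ' 9).toNat = i := by
      simp only [hρ', Function.update_self, BitVec.toNat_ofNat]
      exact Nat.mod_eq_of_lt (by omega)
    refine Ev.ifEq (fun he => ?_) (fun hne => ?_)
    · have : v = i := by rw [← h9, ← he, hag r hr, hv]
      subst this
      exact (h ρ' hag).mono (by omega) fun _ h => h
    · have : v ≠ i := by
        rintro rfl
        exact hne (BitVec.eq_of_toNat_eq (by rw [h9, hag r hr, hv]))
      exact ih (by rw [hag r hr, hv]) (i + 1) (by omega) (by omega)
        fun ρ'' h'' => h ρ'' fun q hq => (h'' q hq).trans (hag q hq)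

theorem Ev.switch_of_le {r : ℕ} {f : ℕ → Stmt} {dflt : Stmt} {ρ : Regs w} {k v : ℕ}
    {Q : Regs w → Prop} (hr : r ≠ 9) (hv : (ρ r).toNat = v) (i m : ℕ)
    (him : i + m ≤ v) (h : ∀ ρ' : Regs w, (∀ q ≠ 9, ρ' q = ρ q) → Ev D dflt ρ' k Q) :
    Ev D (switch r f dflt i m) ρ (k + 3 * m) Q := by
  induction m generalizing i ρ with
  | zero => exact h ρ fun _ _ => rfl
  | succ m ih =>
    have hvw : v < 2 ^ w := hv ▸ (ρ r).isLt
    refine (Ev.seq (k₂ := k + 3 * m + 2) (Ev.block ?_)).mono (by simp; omega) fun _ h => h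
    simp only [List.foldl_cons, List.foldl_nil, Basic.exec]
    set ρ' := Function.update ρ 9 (BitVec.ofNat w i) with hρ'
    have hag : ∀ q ≠ 9, ρ' q = ρ q := fun q hq => by simp [hρ', hq]
    have h9 : (ρ' 9).toNat = i := by
      simp only [hρ', Function.update_self, BitVec.toNat_ofNat]
      exact Nat.mod_eq_of_lt (by omega)
    refine Ev.ifEq_neg ?_ ?_
    · intro he
      have : v = i := by rw [← h9, ← he, hag r hr, hv]
      omega
    · exact ih (by rw [hag r hr, hv]) (i + 1) (by omega)
        fun ρ'' h'' => h ρ'' fun q hq => (h'' q hq).trans (hag q hq)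

/-- Read `m` bits of the memory, starting with the bit at position `p`, and branch to `leaf`
at the number that they form together with `acc`. Registers `4` and `5` hold the address of the
current word and the position in it, and register `6` holds `1`. -/
def bitTree (leaf : ℕ → Stmt) : ℕ → ℕ → ℕ → Stmt
  | 0, acc, _ => leaf acc
  | m + 1, acc, p =>
    .seq (.block [.load 7 4, .op .shr 7 7 5, .op .land 7 7 6, .op .add 5 5 6])
      (.seq (.ifEq 5 2 (.block [.op .sub 5 5 5, .op .add 4 4 6]) (.block []))
        (.ifEq 7 6 (bitTree leaf m (acc + 2 ^ p) (p + 1)) (bitTree leaf m acc (p + 1))))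

theorem toNat_memWord (D : BitVec s) (i : ℕ) :
    (memWord w D i).toNat = D.toNat / 2 ^ (i * w) % 2 ^ w := by
  simp [memWord, BitVec.extractLsb'_toNat, Nat.shiftRight_eq_div_pow]

theorem bit_of_word (X w p : ℕ) (hw : 0 < w) :
    X / 2 ^ (p / w * w) % 2 ^ w / 2 ^ (p % w) % 2 = X / 2 ^ p % 2 := by
  have h1 : p % w < w := Nat.mod_lt _ hw
  have h2 : p / w * w + p % w = p := by rw [mul_comm]; exact Nat.div_add_mod p w
  rw [← Nat.toNat_testBit, ← Nat.toNat_testBit, Nat.testBit_mod_two_pow, Nat.testBit_div_two_pow]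
  simp [h1, add_comm (p % w), h2]

/-- The number read so far is encoded in the position in the program, not in a register, because it
may be longer than a word. For the same reason the address advances whenever the offset reaches $w$.
-/
theorem Ev.bitTree {leaf : ℕ → Stmt} {Q : Regs w → Prop} {k : ℕ} (hw : 0 < w) (m p : ℕ)
    (hp : (p + m) / w < 2 ^ w) (ρ : Regs w) (h2 : (ρ 2).toNat = w)
    (h4 : (ρ 4).toNat = p / w) (h5 : (ρ 5).toNat = p % w) (h6 : (ρ 6).toNat = 1)
    (h : ∀ ρ' : Regs w, Ev D (leaf (D.toNat % 2 ^ (p + m))) ρ' k Q) :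
    Ev D (bitTree leaf m (D.toNat % 2 ^ p) p) ρ (k + 10 * m) Q := by
  induction m generalizing p ρ with
  | zero => exact h ρ
  | succ m ih =>
    have hlt : p % w < w := Nat.mod_lt _ hw
    have hww : w < 2 ^ w := Nat.lt_two_pow_self
    have hdm : w * (p / w) + p % w = p := Nat.div_add_mod p w
    have hpw : (p + 1) / w < 2 ^ w := (Nat.div_le_div_right (by omega)).trans_lt hp
    refine (Ev.seq (k₂ := 4 + (k + 10 * m + 2)) (Ev.block ?_)).mono (by simp; omega) fun _ h => h
    set ρ₁ : Regs w := List.foldl (Basic.exec D) ρ _ with hρ₁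
    have a2 : (ρ₁ 2).toNat = w := by simp [hρ₁, Basic.exec, h2]
    have a4 : (ρ₁ 4).toNat = p / w := by simp [hρ₁, Basic.exec, h4]
    have a6 : (ρ₁ 6).toNat = 1 := by simp [hρ₁, Basic.exec, h6]
    have a5 : (ρ₁ 5).toNat = p % w + 1 := by
      simp only [hρ₁, Basic.exec, List.foldl_cons, List.foldl_nil, Function.update_self, ne_eq,
        BinOp.eval, BitVec.toNat_add, Function.update_of_ne, Nat.reduceEqDiff, not_false_eq_true,
        h5, h6]
      exact Nat.mod_eq_of_lt (by omega)
    have a7 : (ρ₁ 7).toNat = D.toNat / 2 ^ p % 2 := by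
      simp [hρ₁, Basic.exec, BinOp.eval, h4, h5, h6, toNat_memWord, Nat.and_one_is_mod,
        Nat.shiftRight_eq_div_pow, bit_of_word _ _ _ hw]
    clear_value ρ₁
    refine Ev.seq (k₁ := 4) ?_
    refine Ev.mono (k := 2 + 2) (Q := fun ρ₂ => (ρ₂ 2).toNat = w ∧ (ρ₂ 4).toNat = (p + 1) / w ∧
      (ρ₂ 5).toNat = (p + 1) % w ∧ (ρ₂ 6).toNat = 1 ∧ (ρ₂ 7).toNat = D.toNat / 2 ^ p % 2)
      (Ev.ifEq (fun he => ?_) (fun hne => ?_)) le_rfl ?_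
    · have he' : p % w + 1 = w := by rw [← a5, he, a2]
      have e1 : p + 1 = w * (p / w + 1) := by rw [mul_add]; omega
      have e2 : (p + 1) / w = p / w + 1 := by rw [e1, Nat.mul_div_cancel_left _ hw]
      have e3 : (p + 1) % w = 0 := by rw [e1, Nat.mul_mod_right]
      refine Ev.block ?_
      refine ⟨by simp [Basic.exec, a2], ?_, ?_, by simp [Basic.exec, a6],
        by simp [Basic.exec, a7]⟩
      · simp only [Basic.exec, List.foldl_cons, List.foldl_nil, Function.update_self, ne_eq,
          BinOp.eval, BitVec.toNat_add, Function.update_of_ne, Nat.reduceEqDiff,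
          not_false_eq_true, a4, a6, e2]
        exact Nat.mod_eq_of_lt (by omega)
      · simp [Basic.exec, BinOp.eval, e3]
    · have hne' : p % w + 1 ≠ w := fun he => hne (BitVec.eq_of_toNat_eq (by rw [a5, a2, he]))
      have e1 : p + 1 = (p % w + 1) + w * (p / w) := by omega
      have e2 : (p + 1) / w = p / w := by
        rw [e1, Nat.add_mul_div_left _ _ hw, Nat.div_eq_of_lt (by omega), zero_add]
      have e3 : (p + 1) % w = p % w + 1 := by
        rw [e1, Nat.add_mul_mod_self_left, Nat.mod_eq_of_lt (by omega)]
      exact (Ev.block (by simp [a2, a4, a5, a6, a7, e2, e3])).mono (by simp) fun _ h => h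
    · rintro ρ₂ ⟨b2, b4, b5, b6, b7⟩
      have key : D.toNat % 2 ^ (p + 1) = D.toNat % 2 ^ p + 2 ^ p * (D.toNat / 2 ^ p % 2) :=
        Nat.mod_pow_succ
      have hr := ih (p + 1) (by rwa [show p + 1 + m = p + (m + 1) by ring]) ρ₂ b2 b4 b5 b6
        (by rwa [show p + 1 + m = p + (m + 1) by ring])
      refine Ev.ifEq (fun he => ?_) (fun hne => ?_)
      · rw [he, b6] at b7
        rwa [key, ← b7, mul_one] at hr
      · have : D.toNat / 2 ^ p % 2 ≠ 1 := fun h1 =>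
          hne (BitVec.eq_of_toNat_eq (by rw [b7, b6, h1]))
        rwa [key, show D.toNat / 2 ^ p % 2 = 0 by omega, mul_zero, add_zero] at hr

/-- For `n < N`, output `g n x X` where `X` is the number formed by the first
`Nat.log 2 (n ^ n)` bits of the memory; otherwise go on with `dflt`. -/
def tableStmt (g : ℕ → ℕ → ℕ → ℕ) (N : ℕ) (dflt : Stmt) : Stmt :=
  switch 1 (fun n => switch 0 (fun x => .seq (.block [.const 4 0, .const 5 0, .const 6 1])
    (bitTree (fun X => .block [.const 0 (g n x X)]) (Nat.log 2 (n ^ n)) 0 0)) (.block []) 0 n)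
    dflt 0 N

theorem Ev.tableStmt {g : ℕ → ℕ → ℕ → ℕ} {N n x : ℕ} {dflt : Stmt}
    {D : BitVec (Nat.log 2 (n ^ n))} {ρ : Regs w} (hw : 0 < w) (hnN : n < N) (hxn : x < n)
    (hnw : n < 2 ^ w) (h0 : (ρ 0).toNat = x) (h1 : (ρ 1).toNat = n) (h2 : (ρ 2).toNat = w)
    (hg : g n x D.toNat < n) :
    Ev D (tableStmt g N dflt) ρ (4 + 10 * Nat.log 2 (N ^ N) + 3 * N + 3 * N)
      fun ρ' => (ρ' 0).toNat = g n x D.toNat := by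
  have hlog : Nat.log 2 (n ^ n) ≤ Nat.log 2 (N ^ N) :=
    Nat.log_mono_right ((Nat.pow_le_pow_left hnN.le n).trans
      (Nat.pow_le_pow_right (by omega) hnN.le))
  -- Word addresses do not overflow: $n<2^w$ gives $\lfloor\lg n^n\rfloor\le wn$, hence at most $n$
  -- full words.
  have hdiv : Nat.log 2 (n ^ n) / w < 2 ^ w := by
    refine lt_of_le_of_lt ?_ hnw
    refine (Nat.div_le_iff_le_mul_add_pred hw).2 ?_
    refine le_trans ?_ (Nat.le_add_right _ _)
    have : Nat.log 2 (n ^ n) ≤ Nat.log 2 (2 ^ (w * n)) := by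
      rw [pow_mul]
      exact Nat.log_mono_right (Nat.pow_le_pow_left hnw.le n)
    rwa [Nat.log_pow (by norm_num)] at this
  refine Ev.switch_of_lt (by norm_num) h1 0 N (by omega) (by omega) fun ρ₁ e₁ => ?_
  refine Ev.mono (k := 3 + (1 + 10 * Nat.log 2 (n ^ n)) + 3 * n)
    (Ev.switch_of_lt (v := x) (by norm_num) (by rw [e₁ 0 (by norm_num), h0]) 0 n (by omega)
      (by omega) fun ρ₂ e₂ => ?_) (by omega) fun _ h => h
  refine Ev.seq (Ev.block ?_)
  have hX : D.toNat % 2 ^ Nat.log 2 (n ^ n) = D.toNat := Nat.mod_eq_of_lt D.isLt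
  have := Ev.bitTree (D := D) (leaf := fun X => .block [.const 0 (g n x X)]) (k := 1)
    (Q := fun ρ' => (ρ' 0).toNat = g n x D.toNat) hw (Nat.log 2 (n ^ n)) 0 (by simpa using hdiv)
    ([.const 4 0, .const 5 0, .const 6 1].foldl (Basic.exec D) ρ₂)
    (by simp [Basic.exec, e₂, e₁, h2]) (by simp [Basic.exec]) (by simp [Basic.exec])
    (by simp [Basic.exec, Nat.mod_eq_of_lt (Nat.one_lt_two_pow hw.ne')])
    (fun ρ' => Ev.block (by
      simp only [zero_add, hX, Basic.exec, List.foldl_cons, List.foldl_nil, Function.update_self,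
        BitVec.toNat_ofNat]
      exact Nat.mod_eq_of_lt (by omega)))
  simpa [Nat.mod_one] using this

end WordRAM

/-! ### Reading a bit field from packed words. -/

namespace WordRAM

variable {s w : ℕ} {D : BitVec s}

/-- Field number `j` of the number `X`, for fields of `B` bits. -/
def field (X B j : ℕ) : ℕ := X / 2 ^ (j * B) % 2 ^ B

/-- A window of $w$ bits meets at most two consecutive words. If it is aligned, the second word is
shifted by $w$ places and contributes $0$. -/
theorem mod_two_pow_of_words (X w p : ℕ) (hw : 0 < w) :
    X / 2 ^ (p / w * w) % 2 ^ w / 2 ^ (p % w) +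
      X / 2 ^ ((p / w + 1) * w) % 2 ^ w * 2 ^ (w - p % w) % 2 ^ w = X / 2 ^ p % 2 ^ w := by
  have h1 : p % w < w := Nat.mod_lt _ hw
  have h2 : p / w * w + p % w = p := by rw [mul_comm]; exact Nat.div_add_mod p w
  set o := p % w with ho
  obtain ⟨v, hv⟩ : ∃ v, w = o + v := ⟨w - o, by omega⟩
  have h3 : w - o = v := by omega
  have e1 : X / 2 ^ (p / w * w) % 2 ^ w / 2 ^ o = X / 2 ^ p % 2 ^ v := by
    rw [hv, pow_add, Nat.mod_mul_right_div_self, ← hv, Nat.div_div_eq_div_mul, ← pow_add, h2]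
  have e2 : X / 2 ^ ((p / w + 1) * w) = X / 2 ^ p / 2 ^ v := by
    rw [Nat.div_div_eq_div_mul, ← pow_add]
    congr 2
    rw [add_mul, one_mul]; omega
  have e3 : X / 2 ^ p / 2 ^ v % 2 ^ w * 2 ^ v % 2 ^ w =
      2 ^ v * (X / 2 ^ p / 2 ^ v % 2 ^ o) := by
    rw [hv, pow_add, Nat.mul_mod_mul_right, mul_comm, Nat.mod_mul_right_mod]
  rw [e1, e2, h3, e3, ← Nat.mod_mul, ← pow_add, add_comm v, ← hv]

/-- Read the field whose number is in register `12` into register `11`. Register `2` holds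
the word length, register `4` the width of the fields, and register `10` holds `1`. -/
def fieldCode : List Basic :=
  [.op .mul 12 12 4, .op .div 13 12 2, .op .mod 14 12 2, .load 15 13, .op .shr 15 15 14,
    .op .add 13 13 10, .load 16 13, .op .sub 14 2 14, .op .shl 16 16 14, .op .add 11 15 16,
    .op .shl 12 10 4, .op .mod 11 11 12]

theorem Ev.fieldCode {ρ : Regs w} {B j : ℕ} {Q : Regs w → Prop} (hB : 0 < B) (hBw : B < w)
    (hj : j * B < 2 ^ w) (h2 : (ρ 2).toNat = w) (h4 : (ρ 4).toNat = B)
    (h10 : (ρ 10).toNat = 1) (h12 : (ρ 12).toNat = j)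
    (h : ∀ ρ' : Regs w, (ρ' 11).toNat = field D.toNat B j →
      (∀ q, q < 11 ∨ 16 < q → ρ' q = ρ q) → Q ρ') :
    Ev D (.block fieldCode) ρ 12 Q := by
  refine Ev.block (h _ ?_ ?_)
  · have hw : 0 < w := by omega
    have hww : w < 2 ^ w := Nat.lt_two_pow_self
    have hlt : j * B % w < w := Nat.mod_lt _ hw
    have hdw : j * B / w + 1 < 2 ^ w := by
      have : j * B / w ≤ j * B / 2 := Nat.div_le_div_left (by omega) (by norm_num)
      omega
    have hBp : 2 ^ B < 2 ^ w := Nat.pow_lt_pow_right (by norm_num) hBw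
    have e1 : (2 ^ w - j * B % w + w) % 2 ^ w = w - j * B % w := by
      rw [show 2 ^ w - j * B % w + w = 2 ^ w + (w - j * B % w) by omega, Nat.add_mod_left]
      exact Nat.mod_eq_of_lt (by omega)
    have e2 : (D.toNat / 2 ^ (j * B / w * w) % 2 ^ w / 2 ^ (j * B % w) +
        D.toNat / 2 ^ ((j * B / w + 1) * w) * 2 ^ (w - j * B % w)) % 2 ^ w =
        D.toNat / 2 ^ (j * B) % 2 ^ w := by
      rw [← Nat.mod_mod (D.toNat / 2 ^ (j * B)),
        ← mod_two_pow_of_words D.toNat w (j * B) hw]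
      simp
    simp [WordRAM.fieldCode, Basic.exec, BinOp.eval, h2, h4, h10, h12, toNat_memWord,
      Nat.shiftRight_eq_div_pow, Nat.shiftLeft_eq, Nat.mod_eq_of_lt hj, Nat.mod_eq_of_lt hdw,
      Nat.mod_eq_of_lt hBp, e1, field]
    rw [e2]
    exact Nat.mod_mod_of_dvd _ (pow_dvd_pow 2 hBw.le)
  · intro q hq
    have : q ≠ 11 ∧ q ≠ 12 ∧ q ≠ 13 ∧ q ≠ 14 ∧ q ≠ 15 ∧ q ≠ 16 := by omega
    obtain ⟨_, _, _, _, _, _⟩ := this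
    simp [WordRAM.fieldCode, Basic.exec, *]

/-! ### Ranks and the layout of the memory. -/

/-- The number of elements of `S` below `m`. -/
def rank {n : ℕ} (S : Finset (Fin n)) (m : ℕ) : ℕ := (S.filter fun z : Fin n => (z : ℕ) < m).card

theorem rank_succ {n : ℕ} (S : Finset (Fin n)) (y : Fin n) :
    rank S (y + 1) = rank S y + if y ∈ S then 1 else 0 := by
  unfold rank
  have : (S.filter fun z : Fin n => (z : ℕ) < y + 1) =
      (S.filter fun z : Fin n => (z : ℕ) < y) ∪ S.filter fun z : Fin n => z = y := by
    ext z
    simp only [Finset.mem_filter, Finset.mem_union, Fin.ext_iff]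
    grind
  rw [this, Finset.card_union_of_disjoint, Finset.filter_eq']
  · split_ifs <;> simp
  · rw [Finset.disjoint_filter]
    rintro z - h rfl
    exact lt_irrefl _ h

theorem rank_mono {n : ℕ} (S : Finset (Fin n)) : Monotone (rank S) := fun _ _ h =>
  Finset.card_le_card (Finset.monotone_filter_right S fun _ _ hz => lt_of_lt_of_le hz h)

theorem rank_le_card {n : ℕ} (S : Finset (Fin n)) (m : ℕ) : rank S m ≤ S.card :=
  Finset.card_filter_le _ _

theorem rank_lt_rank {n : ℕ} (S : Finset (Fin n)) {y : Fin n} (hy : y ∈ S) {m : ℕ} (h : y < m) :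
    rank S y < rank S m :=
  lt_of_lt_of_le (by simp [rank_succ, hy]) (rank_mono S (Nat.succ_le_of_lt h))

theorem rank_lt_card {n : ℕ} (S : Finset (Fin n)) {y : Fin n} (hy : y ∈ S) :
    rank S y < S.card :=
  (rank_lt_rank S hy y.isLt).trans_le (rank_le_card S _)

/-- The number of the first of the fields that hold the shortcuts. -/
def shortcutBase (n t : ℕ) : ℕ := n + n / t + 2

/-- The memory contents `X` represent `π` with shortcuts at the elements of `S`. -/
structure Represents {n : ℕ} (π : Equiv.Perm (Fin n)) (S : Finset (Fin n)) (t w X B : ℕ) :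
    Prop where
  t_pos : 0 < t
  two_le : 2 ≤ B
  lt_w : B < w
  word : X % 2 ^ w % n = B
  size_le : (shortcutBase n t + S.card) * B ≤ 2 ^ w
  entry : ∀ y : Fin n, field X B (y + 1) = 2 * (π y : ℕ) + if y ∈ S then 1 else 0
  dir : ∀ r ≤ n / t, field X B (r + n + 1) = shortcutBase n t + rank S (r * t)
  shortcut : ∀ y ∈ S, field X B (shortcutBase n t + rank S y) = ((π ^ t)⁻¹ y : Fin n)
  hit : ∀ x, ∃ k < t, (π ^ k) x ∈ S ∨ (π ^ (k + 1)) x = x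

/-- The registers that are fixed during a query. -/
structure Env (x n w t B : ℕ) (ρ : Regs w) : Prop where
  h0 : (ρ 0).toNat = x
  h1 : (ρ 1).toNat = n
  h2 : (ρ 2).toNat = w
  h3 : (ρ 3).toNat = t
  h4 : (ρ 4).toNat = B
  h10 : (ρ 10).toNat = 1

theorem Env.congr {x n w t B : ℕ} {ρ ρ' : Regs w} (h : Env x n w t B ρ)
    (h' : ∀ q, q < 5 ∨ q = 10 → ρ' q = ρ q) : Env x n w t B ρ' := by
  constructor
  · rw [h' 0 (by norm_num), h.h0]
  · rw [h' 1 (by norm_num), h.h1]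
  · rw [h' 2 (by norm_num), h.h2]
  · rw [h' 3 (by norm_num), h.h3]
  · rw [h' 4 (by norm_num), h.h4]
  · rw [h' 10 (by norm_num), h.h10]

/-! ### The query programs. -/

/-- Read the field width from the first word. -/
def setup : Stmt := .block [.const 10 1, .const 11 0, .load 11 11, .op .mod 4 11 1]

/-- For the element in register `5`, put its image into register `6` and its mark into
register `7`. -/
def fetch : Stmt :=
  .seq (.block [.op .add 12 5 10])
    (.seq (.block fieldCode) (.block [.op .shr 6 11 10, .op .land 7 11 10]))

/-- The program for the images. -/
def fwdStmt : Stmt :=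
  .seq setup (.seq (.block [.copy 5 0]) (.seq fetch (.block [.copy 0 6])))

/-- Walk until the element in register `5` is marked or mapped to the query. -/
def walkToMark : Stmt :=
  .whileNe 8 10 (.seq (.block [.copy 5 6]) (.seq fetch
    (.seq (.block [.copy 8 7]) (.ifEq 6 0 (.block [.copy 8 10]) (.block [])))))

/-- Put the number of the field with the shortcut of the element in register `5` into
register `19`. -/
def findShortcut : Stmt :=
  .seq (.block [.op .div 17 5 3, .op .mul 18 17 3, .op .add 12 17 1, .op .add 12 12 10])
    (.seq (.block fieldCode) (.seq (.block [.copy 19 11])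
      (.whileNe 18 5 (.seq (.block [.op .add 12 18 10]) (.seq (.block fieldCode)
        (.block [.op .land 11 11 10, .op .add 19 19 11, .op .add 18 18 10]))))))

/-- Follow the shortcut whose field number is in register `19`. -/
def followShortcut : Stmt :=
  .seq (.block [.copy 12 19]) (.seq (.block fieldCode) (.seq (.block [.copy 5 11]) fetch))

/-- Walk until the element in register `5` is mapped to the query. -/
def walkToQuery : Stmt := .whileNe 6 0 (.seq (.block [.copy 5 6]) fetch)

/-- The program for the preimages. -/
def invStmt : Stmt :=
  .seq setup (.seq (.block [.copy 6 0, .const 8 0]) (.seq walkToMark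
    (.seq (.ifEq 6 0 (.block []) (.seq findShortcut followShortcut))
      (.seq walkToQuery (.block [.copy 0 5])))))

/-! ### Correctness and running time of the query programs. -/

section

variable {n t B : ℕ} {π : Equiv.Perm (Fin n)} {S : Finset (Fin n)} {x : Fin n} {ρ : Regs w}
  {Q : Regs w → Prop}

/-- The code computes the bit position of a field by a product in one word; this excludes overflow.
-/
theorem Represents.mul_lt (hR : Represents π S t w D.toNat B) {j : ℕ}
    (hj : j < shortcutBase n t + S.card) : j * B < 2 ^ w :=
  lt_of_lt_of_le (Nat.mul_lt_mul_of_pos_right hj (by have := hR.two_le; omega)) hR.size_le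

theorem Represents.lt_two_pow (hR : Represents π S t w D.toNat B) :
    shortcutBase n t + S.card < 2 ^ w := by
  refine lt_of_lt_of_le ?_ hR.size_le
  have : 0 < shortcutBase n t := by simp [shortcutBase]
  nlinarith [hR.two_le]

theorem Represents.setup (hR : Represents π S t w D.toNat B) (h0 : (ρ 0).toNat = x)
    (h1 : (ρ 1).toNat = n) (h2 : (ρ 2).toNat = w) (h3 : (ρ 3).toNat = t)
    (h : ∀ ρ' : Regs w, Env x n w t B ρ' → Q ρ') : Ev D setup ρ 4 Q := by
  have hw : 1 < 2 ^ w := Nat.one_lt_two_pow (by have := hR.lt_w; omega)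
  refine Ev.block (h _ ⟨?_, ?_, ?_, ?_, ?_, ?_⟩)
  all_goals simp [Basic.exec, BinOp.eval, h0, h1, h2, h3, toNat_memWord, hR.word,
    Nat.mod_eq_of_lt hw]

theorem Represents.evField (hR : Represents π S t w D.toNat B) (hE : Env x n w t B ρ) {j : ℕ}
    (h12 : (ρ 12).toNat = j) (hj : j < shortcutBase n t + S.card)
    (h : ∀ ρ' : Regs w, Env x n w t B ρ' → (ρ' 11).toNat = field D.toNat B j →
      (∀ q, q < 11 ∨ 16 < q → ρ' q = ρ q) → Q ρ') :
    Ev D (.block fieldCode) ρ 12 Q :=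
  Ev.fieldCode (by have := hR.two_le; omega) hR.lt_w (hR.mul_lt hj) hE.h2 hE.h4 hE.h10 h12
    fun ρ' h11 hρ' => h ρ' (hE.congr fun q hq => hρ' q (by omega)) h11 hρ'

theorem Represents.fetch (hR : Represents π S t w D.toNat B) (hE : Env x n w t B ρ) {y : Fin n}
    (h5 : (ρ 5).toNat = y)
    (h : ∀ ρ' : Regs w, Env x n w t B ρ' → (ρ' 5).toNat = y → (ρ' 6).toNat = π y →
      ((ρ' 7).toNat = if y ∈ S then 1 else 0) → Q ρ') :
    Ev D fetch ρ 15 Q := by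
  have hlt := hR.lt_two_pow
  have hy := y.isLt
  have hb : n + 2 ≤ shortcutBase n t := by simp [shortcutBase]
  refine (Ev.seq (k₂ := 12 + 2) (Ev.block ?_)).mono (by simp) fun _ h => h
  refine Ev.seq (hR.evField (j := y + 1) (hE.congr ?_) ?_ (by omega)
    fun ρ' hE' h11 hρ' => Ev.block (h _ (hE'.congr ?_) ?_ ?_ ?_))
  · intro q hq
    have : q ≠ 12 := by omega
    simp [Basic.exec, this]
  · simp [Basic.exec, BinOp.eval, h5, hE.h10]
    exact Nat.mod_eq_of_lt (by omega)
  · intro q hq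
    have : q ≠ 6 ∧ q ≠ 7 := by omega
    simp [Basic.exec, this]
  · have := hρ' 5 (by norm_num)
    simp [Basic.exec, this, h5]
  · simp only [List.foldl_cons, Basic.exec, BinOp.eval, BitVec.ushiftRight_eq',
      List.foldl_nil, ne_eq, Nat.reduceEqDiff, not_false_eq_true, Function.update_of_ne,
      Function.update_self, BitVec.toNat_ushiftRight, h11, hE'.h10, hR.entry,
      Nat.shiftRight_eq_div_pow]
    split_ifs <;> omega
  · simp only [List.foldl_cons, Basic.exec, BinOp.eval,
      List.foldl_nil, ne_eq, Nat.reduceEqDiff, not_false_eq_true, Function.update_of_ne,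
      Function.update_self, BitVec.toNat_and, h11, hE'.h10, hR.entry, Nat.and_one_is_mod]
    split_ifs <;> omega

theorem Represents.evFwd (hR : Represents π S t w D.toNat B) (h0 : (ρ 0).toNat = x)
    (h1 : (ρ 1).toNat = n) (h2 : (ρ 2).toNat = w) (h3 : (ρ 3).toNat = t) :
    Ev D fwdStmt ρ 21 fun ρ' => (ρ' 0).toNat = π x := by
  refine Ev.seq (k₁ := 4) (k₂ := 1 + (15 + 1)) (hR.setup h0 h1 h2 h3 fun ρ₁ hE => ?_)
  refine Ev.seq (Ev.block ?_)
  refine Ev.seq (hR.fetch (y := x) (hE.congr ?_) ?_ fun ρ₂ _ _ h6 _ => Ev.block ?_)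
  · intro q hq
    have : q ≠ 5 := by omega
    simp [Basic.exec, this]
  · simp [Basic.exec, hE.h0]
  · simp [Basic.exec, h6]

theorem Represents.walkToMark (hR : Represents π S t w D.toNat B) (hE : Env x n w t B ρ)
    (h6 : (ρ 6).toNat = x) (h8 : (ρ 8).toNat = 0)
    (h : ∀ (ρ' : Regs w) (y : Fin n), Env x n w t B ρ' → (ρ' 5).toNat = y → (ρ' 6).toNat = π y →
      (π y = x ∨ y ∈ S ∧ ∃ i < t, (π ^ i) x = y) → Q ρ') :
    Ev D walkToMark ρ (t * 22 + 1) Q := by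
  -- Register `8` is the stop flag. While it is $0$, $k=t-m$ elements have been examined without
  -- success; `hR.hit` then forces $k<t$, so an iteration is still available.
  refine Ev.whileNe (k := 20) (fun m ρ => Env x n w t B ρ ∧
    (((ρ 8).toNat = 0 ∧ ∃ k, k + m = t ∧ (ρ 6).toNat = (π ^ k) x ∧
      ∀ i < k, ¬ ((π ^ i) x ∈ S ∨ (π ^ (i + 1)) x = x)) ∨
    ((ρ 8).toNat = 1 ∧ ∃ y : Fin n, (ρ 5).toNat = y ∧ (ρ 6).toNat = π y ∧
      (π y = x ∨ y ∈ S ∧ ∃ i < t, (π ^ i) x = y)))) ?_ ?_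
    ⟨hE, Or.inl ⟨h8, 0, by simp, by simpa using h6, by simp⟩⟩
  · rintro m ρ ⟨hE, ⟨h8, k, hk, h6, hno⟩ | ⟨h8, -⟩⟩ hne
    swap
    · exact absurd (BitVec.eq_of_toNat_eq (h8.trans hE.h10.symm)) hne
    have hkt : k < t := by
      obtain ⟨i, hi, h⟩ := hR.hit x
      by_contra hc
      exact hno i (by omega) h
    refine ⟨m - 1, by omega, ?_⟩
    refine Ev.seq (k₁ := 1) (k₂ := 15 + (1 + (1 + 2))) (Ev.block ?_)
    refine Ev.seq (hR.fetch (y := (π ^ k) x) (hE.congr ?_) ?_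
      fun ρ₁ hE₁ h5 h6 h7 => Ev.seq (k₁ := 1) (Ev.block ?_))
    · intro q hq
      have : q ≠ 5 := by omega
      simp [Basic.exec, this]
    · simp [Basic.exec, h6]
    set ρ₂ : Regs w := List.foldl (Basic.exec D) ρ₁ _ with hρ₂
    have a8 : (ρ₂ 8).toNat = if (π ^ k) x ∈ S then 1 else 0 := by
      simp only [← h7, hρ₂, List.foldl_cons, List.foldl_nil, Basic.exec, Function.update_self]
    have a5 : (ρ₂ 5).toNat = (π ^ k) x := by simp [hρ₂, Basic.exec, h5]
    have a6 : (ρ₂ 6).toNat = π ((π ^ k) x) := by simp [hρ₂, Basic.exec, h6]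
    have hE₂ : Env x n w t B ρ₂ := hE₁.congr fun q hq => by
      have : q ≠ 8 := by omega
      simp [hρ₂, Basic.exec, this]
    clear_value ρ₂
    have hpow : π ((π ^ k) x) = (π ^ (k + 1)) x := by rw [pow_succ', Equiv.Perm.mul_apply]
    refine Ev.ifEq (fun he => ?_) (fun hne => ?_)
    · refine Ev.block ⟨hE₂.congr ?_, Or.inr ⟨?_, (π ^ k) x, ?_, ?_, Or.inl ?_⟩⟩
      · intro q hq
        have : q ≠ 8 := by omega
        simp [Basic.exec, this]
      · simp [Basic.exec, hE₂.h10]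
      · simp [Basic.exec, a5]
      · simp [Basic.exec, a6]
      · apply Fin.ext
        rw [← a6, he, hE₂.h0]
    · have hnx : (π ^ (k + 1)) x ≠ x := by
        intro hc
        exact hne (BitVec.eq_of_toNat_eq (by rw [a6, hE₂.h0, hpow, hc]))
      refine Ev.mono (k := 0) (Q := fun ρ' => ρ' = ρ₂) (Ev.block rfl) (by norm_num) ?_
      rintro _ rfl
      refine ⟨hE₂, ?_⟩
      by_cases hS : (π ^ k) x ∈ S
      · exact Or.inr ⟨by simp [a8, hS], _, a5, a6, Or.inr ⟨hS, k, hkt, rfl⟩⟩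
      · refine Or.inl ⟨by simp [a8, hS], k + 1, by omega, by rw [a6, hpow], fun i hi => ?_⟩
        rcases Nat.lt_succ_iff_lt_or_eq.1 hi with hi | rfl
        · exact hno i hi
        · exact not_or.2 ⟨hS, hnx⟩
  · rintro m ρ ⟨hE, ⟨h8, -⟩ | ⟨h8, y, h5, h6, hy⟩⟩ he
    · rw [he, hE.h10] at h8
      omega
    · exact h ρ y hE h5 h6 hy

theorem Represents.findShortcut (hR : Represents π S t w D.toNat B) (hE : Env x n w t B ρ)
    {y : Fin n} (h5 : (ρ 5).toNat = y)
    (h : ∀ (ρ' : Regs w), Env x n w t B ρ' → (ρ' 19).toNat = shortcutBase n t + rank S y → Q ρ') :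
    Ev D findShortcut ρ (17 + (t * 18 + 1)) Q := by
  have hlt := hR.lt_two_pow
  have hyn := y.isLt
  have ht := hR.t_pos
  have hb : shortcutBase n t = n + n / t + 2 := rfl
  have hb' : n + 2 ≤ shortcutBase n t := by simp [shortcutBase]
  have hyt : (y : ℕ) / t ≤ n / t := Nat.div_le_div_right hyn.le
  have hytl : (y : ℕ) / t * t ≤ y := Nat.div_mul_le_self _ _
  have hym : (y : ℕ) / t * t + (y : ℕ) % t = y := by rw [mul_comm]; exact Nat.div_add_mod _ _
  have hmt : (y : ℕ) % t < t := Nat.mod_lt _ ht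
  refine (Ev.seq (k₂ := 12 + (1 + (t * 18 + 1))) (Ev.block ?_)).mono (by simp; omega)
    fun _ h => h
  set ρ₁ : Regs w := List.foldl (Basic.exec D) ρ _ with hρ₁
  have hE₁ : Env x n w t B ρ₁ := hE.congr fun q hq => by
    have : q ≠ 17 ∧ q ≠ 18 ∧ q ≠ 12 := by omega
    simp [hρ₁, Basic.exec, this]
  have a5 : (ρ₁ 5).toNat = y := by simp [hρ₁, Basic.exec, h5]
  have a18 : (ρ₁ 18).toNat = y / t * t := by
    simp [hρ₁, Basic.exec, BinOp.eval, h5, hE.h3]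
    exact Nat.mod_eq_of_lt (by omega)
  have a12 : (ρ₁ 12).toNat = y / t + n + 1 := by
    simp [hρ₁, Basic.exec, BinOp.eval, h5, hE.h3, hE.h1, hE.h10]
    exact Nat.mod_eq_of_lt (by omega)
  clear_value ρ₁
  refine Ev.seq (hR.evField hE₁ a12 (by omega) fun ρ₂ hE₂ b11 hρ₂ => ?_)
  have b5 : (ρ₂ 5).toNat = y := by rw [hρ₂ 5 (by norm_num), a5]
  have b18 : (ρ₂ 18).toNat = y / t * t := by rw [hρ₂ 18 (by norm_num), a18]
  rw [hR.dir _ hyt] at b11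
  refine Ev.seq (k₁ := 1) (Ev.block ?_)
  -- The directory entry accounts for the marks below $\lfloor y/t\rfloor t$, which leaves $y\bmod
  -- t$ mark bits to add.
  refine Ev.mono (k := (y : ℕ) % t * (16 + 2) + 1) (Q := Q) ?_ (by omega) fun _ h => h
  refine Ev.whileNe (k := 16) (fun m ρ => Env x n w t B ρ ∧ (ρ 5).toNat = y ∧ ∃ j, j + m = y ∧
    (ρ 18).toNat = j ∧ (ρ 19).toNat = shortcutBase n t + rank S j) ?_ ?_
    ⟨hE₂.congr ?_, ?_, y / t * t, hym, ?_, ?_⟩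
  · rintro m ρ ⟨hE, h5, j, hj, h18, h19⟩ hne
    have hm : m ≠ 0 := by
      rintro rfl
      exact hne (BitVec.eq_of_toNat_eq (by rw [h18, h5, ← hj, add_zero]))
    refine ⟨m - 1, by omega, ?_⟩
    refine Ev.seq (k₁ := 1) (k₂ := 12 + 3) (Ev.block ?_)
    refine Ev.seq (hR.evField (j := j + 1) (hE.congr ?_) ?_ (by omega)
      fun ρ' hE' h11 hρ' => Ev.block ⟨hE'.congr ?_, ?_, j + 1, by omega, ?_, ?_⟩)
    · intro q hq
      have : q ≠ 12 := by omega
      simp [Basic.exec, this]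
    · simp [Basic.exec, BinOp.eval, h18, hE.h10]
      exact Nat.mod_eq_of_lt (by omega)
    · intro q hq
      have : q ≠ 11 ∧ q ≠ 19 ∧ q ≠ 18 := by omega
      simp [Basic.exec, this]
    · have := hρ' 5 (by norm_num)
      simp [Basic.exec, this, h5]
    · have := hρ' 18 (by norm_num)
      simp [Basic.exec, BinOp.eval, this, h18, hE'.h10]
      exact Nat.mod_eq_of_lt (by omega)
    · have := hρ' 19 (by norm_num)
      have hjn : j < n := by omega
      have e1 := hR.entry ⟨j, hjn⟩
      have e2 := rank_succ S ⟨j, hjn⟩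
      have e3 := rank_le_card S (j + 1)
      simp only at e1 e2
      simp [Basic.exec, BinOp.eval, this, h19, h11, hE'.h10, Nat.and_one_is_mod]
      rw [Nat.mod_eq_of_lt] <;> split_ifs at e1 e2 <;> omega
  · rintro m ρ ⟨hE, h5, j, hj, h18, h19⟩ he
    refine h ρ hE ?_
    rw [h19, ← h18, he, h5]
  · intro q hq
    have : q ≠ 19 := by omega
    simp [Basic.exec, this]
  · simp [Basic.exec, b5]
  · simp [Basic.exec, b18]
  · simp [Basic.exec, b11]

theorem Represents.followShortcut (hR : Represents π S t w D.toNat B) (hE : Env x n w t B ρ)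
    {y : Fin n} (hy : y ∈ S) (h19 : (ρ 19).toNat = shortcutBase n t + rank S y)
    (h : ∀ (ρ' : Regs w), Env x n w t B ρ' → (ρ' 5).toNat = ((π ^ t)⁻¹ y : Fin n) →
      (ρ' 6).toNat = π ((π ^ t)⁻¹ y) → Q ρ') :
    Ev D followShortcut ρ 29 Q := by
  have := rank_lt_card S hy
  refine Ev.seq (k₁ := 1) (k₂ := 12 + (1 + 15)) (Ev.block ?_)
  refine Ev.seq (hR.evField (hE.congr ?_) (j := shortcutBase n t + rank S y) ?_ (by omega)
    fun ρ₁ hE₁ h11 _ => Ev.seq (k₁ := 1) (Ev.block ?_))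
  · intro q hq
    have : q ≠ 12 := by omega
    simp [Basic.exec, this]
  · simp [Basic.exec, h19]
  · rw [hR.shortcut y hy] at h11
    refine hR.fetch (hE₁.congr ?_) (y := (π ^ t)⁻¹ y) ?_ fun ρ' hE' h5 h6 _ => h ρ' hE' h5 h6
    · intro q hq
      have : q ≠ 5 := by omega
      simp [Basic.exec, this]
    · simp only [List.foldl_cons, List.foldl_nil, Basic.exec, Function.update_self, h11]

theorem Represents.walkToQuery (hR : Represents π S t w D.toNat B) (hE : Env x n w t B ρ)
    {y : Fin n} {m : ℕ} (h5 : (ρ 5).toNat = y) (h6 : (ρ 6).toNat = π y)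
    (hm : (π ^ (m + 1)) y = x)
    (h : ∀ (ρ' : Regs w), (ρ' 5).toNat = (π⁻¹ x : Fin n) → Q ρ') :
    Ev D walkToQuery ρ (m * 18 + 1) Q := by
  refine Ev.whileNe (k := 16) (fun m ρ => Env x n w t B ρ ∧ ∃ y : Fin n, (ρ 5).toNat = y ∧
    (ρ 6).toNat = π y ∧ (π ^ (m + 1)) y = x) ?_ ?_ ⟨hE, y, h5, h6, hm⟩
  · rintro m ρ ⟨hE, y, h5, h6, hm⟩ hne
    have hm0 : m ≠ 0 := by
      rintro rfl
      exact hne (BitVec.eq_of_toNat_eq (by rw [h6, hE.h0, ← hm, zero_add, pow_one]))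
    obtain ⟨m, rfl⟩ := Nat.exists_eq_succ_of_ne_zero hm0
    refine ⟨m, rfl, Ev.seq (k₁ := 1) (k₂ := 15) (Ev.block ?_)⟩
    refine hR.fetch (hE.congr ?_) (y := π y) ?_ fun ρ' hE' h5' h6' _ =>
      ⟨hE', π y, h5', h6', ?_⟩
    · intro q hq
      have : q ≠ 5 := by omega
      simp [Basic.exec, this]
    · simp [Basic.exec, h6]
    · rwa [pow_succ, Equiv.Perm.mul_apply] at hm
  · rintro m ρ ⟨hE, y, h5, h6, hm⟩ he
    refine h ρ ?_
    rw [h5]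
    congr 1
    rw [Equiv.Perm.eq_inv_iff_eq]
    apply Fin.ext
    rw [← h6, he, hE.h0]

theorem Represents.evInv (hR : Represents π S t w D.toNat B) (h0 : (ρ 0).toNat = x)
    (h1 : (ρ 1).toNat = n) (h2 : (ρ 2).toNat = w) (h3 : (ρ 3).toNat = t) :
    Ev D invStmt ρ (200 * t) fun ρ' => (ρ' 0).toNat = (π⁻¹ x : Fin n) := by
  have ht := hR.t_pos
  refine Ev.mono (k := 4 + (2 + ((t * 22 + 1) + ((17 + (t * 18 + 1) + 29 + 2) +
    ((t * 18 + 1) + 1))))) ?_ (by omega) fun _ h => h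
  refine Ev.seq (hR.setup h0 h1 h2 h3 fun ρ₁ hE => ?_)
  refine Ev.seq (k₁ := 2) (Ev.block ?_)
  refine Ev.seq (hR.walkToMark (hE.congr ?_) ?_ ?_ fun ρ₂ y hE₂ h5 h6 hy => ?_)
  · intro q hq
    have : q ≠ 6 ∧ q ≠ 8 := by omega
    simp [Basic.exec, this]
  · simp [Basic.exec, hE.h0]
  · simp [Basic.exec]
  refine Ev.seq (Ev.mono (k := 17 + (t * 18 + 1) + 29 + 2)
    (Q := fun ρ' => Env x n w t B ρ' ∧ ∃ z : Fin n,
      (ρ' 5).toNat = z ∧ (ρ' 6).toNat = π z ∧ ∃ m < t, (π ^ (m + 1)) z = x) ?_ le_rfl ?_)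
  · refine Ev.ifEq (fun he => ?_) (fun hne => ?_)
    · refine (Ev.block ?_).mono (Nat.zero_le _) fun _ h => h
      refine ⟨hE₂, y, h5, h6, 0, ht, ?_⟩
      apply Fin.ext
      rw [zero_add, pow_one, ← hE₂.h0, ← he]
      exact h6.symm
    · have hyx : π y ≠ x := by
        intro hc
        exact hne (BitVec.eq_of_toNat_eq (by rw [h6, hE₂.h0, hc]))
      obtain ⟨hS, i, hi, hix⟩ := hy.resolve_left hyx
      -- The shortcut goes $t$ steps back from $\pi^i(x)$, thus to $t-i$ steps before $x$; the
      -- predecessor of $x$ comes one step earlier than $x$. Both sides are compared after applying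
      -- $\pi^i$.
      refine Ev.seq (hR.findShortcut hE₂ h5 fun ρ₃ hE₃ h19 =>
        hR.followShortcut hE₃ hS h19 fun ρ₄ hE₄ h5 h6 => ⟨hE₄, _, h5, h6, t - i - 1, by omega, ?_⟩)
      apply (π ^ i).injective
      rw [hix, ← Equiv.Perm.mul_apply, ← pow_add, show i + (t - i - 1 + 1) = t by omega]
      simp
  · rintro ρ₃ ⟨hE₃, z, h5, h6, m, hmt, hm⟩
    refine Ev.seq (k₁ := t * 18 + 1) ((hR.walkToQuery hE₃ h5 h6 hm
      fun ρ' h5' => Ev.block ?_).mono (by omega) fun _ h => h)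
    simp only [List.foldl_cons, List.foldl_nil, Basic.exec, Function.update_self, h5']

end

end WordRAM

/-! ### Choice of the marked elements. -/

namespace WordRAM

/-- Marking few elements suffices so that every walk of length `t` meets a marked element or
closes its cycle. -/
theorem exists_hitting_set {n : ℕ} (π : Equiv.Perm (Fin n)) {t : ℕ} (ht : 0 < t) :
    ∃ S : Finset (Fin n), S.card * t ≤ 2 * n ∧
      ∀ x, ∃ k < t, (π ^ k) x ∈ S ∨ (π ^ (k + 1)) x = x := by
  classical
  -- Take a maximal set whose forward segments of $h=\lceil t/2\rceil$ elements are disjoint and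
  -- free of repetitions. Counting gives $|S|h\le n$.
  set h := (t + 1) / 2 with hh
  let good : Finset (Fin n) → Prop := fun S =>
    Set.InjOn (fun q : Fin n × ℕ => (π ^ q.2) q.1) (S ×ˢ Finset.range h : Finset (Fin n × ℕ))
  obtain ⟨S, hS, hmax⟩ : ∃ S, good S ∧ ∀ S', good S' → S ⊆ S' → S' = S := by
    obtain ⟨S, hS⟩ := (Set.toFinite {S | good S}).exists_maximal ⟨∅, by simp [good]⟩
    exact ⟨S, hS.1, fun S' h1 h2 => (hS.2 h1 h2).antisymm h2⟩
  refine ⟨S, ?_, fun x => ?_⟩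
  · have h1 : (S ×ˢ Finset.range h).card ≤ (Finset.univ : Finset (Fin n)).card :=
      Finset.card_le_card_of_injOn (fun q : Fin n × ℕ => (π ^ q.2) q.1) (by simp) hS
    rw [Finset.card_product, Finset.card_range, Finset.card_univ, Fintype.card_fin] at h1
    calc S.card * t ≤ S.card * (2 * h) := Nat.mul_le_mul_left _ (by omega)
      _ = 2 * (S.card * h) := by ring
      _ ≤ 2 * n := by omega
  · by_contra hcon
    push Not at hcon
    have hpow (i j : ℕ) (y z : Fin n) (hij : i ≤ j) (he : (π ^ i) y = (π ^ j) z) :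
        y = (π ^ (j - i)) z := by
      apply (π ^ i).injective
      rw [he, ← Equiv.Perm.mul_apply, ← pow_add, Nat.add_sub_cancel' hij]
    -- If the walk from $x$ failed, $y$ could be added to $S$. Starting $h-1$ steps after $x$
    -- ensures that a collision with the segment of $z\in S$ puts $z$ itself on the walk, after at
    -- most $2(h-1)<t$ steps.
    set y := (π ^ (h - 1)) x with hy
    have hyx (i : ℕ) : (π ^ i) y = (π ^ (i + (h - 1))) x := by
      rw [hy, ← Equiv.Perm.mul_apply, ← pow_add]
    have hself (i j : ℕ) (hij : i < j) (hj : j < h) : (π ^ i) y ≠ (π ^ j) y := by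
      intro he
      rw [hyx, hyx] at he
      have := hpow _ _ _ _ (by omega) he
      refine (hcon (j - i - 1) (by omega)).2 ?_
      rw [show j - i - 1 + 1 = j + (h - 1) - (i + (h - 1)) by omega]
      exact this.symm
    have hcross (z : Fin n) (hz : z ∈ S) (i j : ℕ) (hi : i < h) (hj : j < h) :
        (π ^ i) z ≠ (π ^ j) y := by
      intro he
      rw [hyx] at he
      have := hpow _ _ _ _ (by omega) he
      exact (hcon (j + (h - 1) - i) (by omega)).1 (this ▸ hz)
    have hgood : good (insert y S) := by
      rintro ⟨z, i⟩ h1 ⟨z', j⟩ h2 he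
      simp only [Finset.coe_product, Set.mem_prod, Finset.mem_coe, Finset.mem_insert,
        Finset.mem_range] at h1 h2
      simp only at he
      obtain ⟨hz, hi⟩ := h1
      obtain ⟨hz', hj⟩ := h2
      rcases hz with rfl | hz <;> rcases hz' with rfl | hz'
      · rcases lt_trichotomy i j with hij | rfl | hij
        · exact absurd he (hself i j hij hj)
        · rfl
        · exact absurd he.symm (hself j i hij hi)
      · exact absurd he.symm (hcross z' hz' j i hj hi)
      · exact absurd he (hcross z hz i j hi hj)
      · exact hS (by simp [hz, hi]) (by simp [hz', hj]) he
    have : y ∈ S := by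
      rw [← hmax _ hgood (Finset.subset_insert _ _)]
      exact Finset.mem_insert_self _ _
    exact (hcon (h - 1) (by omega)).1 this

/-! ### Packing the fields and the header. -/

theorem field_succ (h X B j : ℕ) (hh : h < 2 ^ B) :
    field (h + 2 ^ B * X) B (j + 1) = field X B j := by
  unfold field
  rw [add_mul, one_mul, add_comm (j * B), pow_add, ← Nat.div_div_eq_div_mul,
    Nat.add_mul_div_left _ _ (by positivity), Nat.div_eq_of_lt hh, zero_add]

theorem add_two_pow_mul_lt {h X B L : ℕ} (hh : h < 2 ^ B) (hX : X < 2 ^ (L * B)) :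
    h + 2 ^ B * X < 2 ^ ((L + 1) * B) := by
  rw [add_mul, one_mul, pow_add]
  nlinarith

theorem exists_fields (B L : ℕ) (F : ℕ → ℕ) (hF : ∀ j < L, F j < 2 ^ B) :
    ∃ X < 2 ^ (L * B), ∀ j < L, field X B j = F j := by
  induction L generalizing F with
  | zero => exact ⟨0, by simp, by simp⟩
  | succ L ih =>
    obtain ⟨X, hX, h⟩ := ih (fun j => F (j + 1)) fun j hj => hF _ (by omega)
    have h0 := hF 0 (by omega)
    refine ⟨F 0 + 2 ^ B * X, add_two_pow_mul_lt h0 hX, fun j hj => ?_⟩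
    cases j with
    | zero => simp [field, Nat.mod_eq_of_lt h0]
    | succ j => rw [field_succ _ _ _ _ h0, h j (by omega)]

/-- This supplies the header: whatever the rest $r$ of the first word is, some $h<n$ corrects its
residue to the field width. -/
theorem exists_add_mod_eq {n c : ℕ} (hc : c < n) (r : ℕ) : ∃ h < n, (h + r) % n = c := by
  have hr : r % n < n := Nat.mod_lt _ (by omega)
  refine ⟨(c + (n - r % n)) % n, Nat.mod_lt _ (by omega), ?_⟩
  have h1 := Nat.div_add_mod r n
  rw [Nat.mod_add_mod, show c + (n - r % n) + r = c + n * (r / n + 1) by rw [mul_add]; omega,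
    Nat.add_mul_mod_self_left, Nat.mod_eq_of_lt hc]

theorem rank_injOn {n : ℕ} (S : Finset (Fin n)) :
    Set.InjOn (fun y : Fin n => rank S y) (S : Set (Fin n)) := by
  intro y hy z hz he
  by_contra hne
  rcases lt_or_gt_of_ne hne with h | h
  · exact absurd he (rank_lt_rank S hy h).ne
  · exact absurd he (rank_lt_rank S hz h).ne'

theorem exists_represents {n : ℕ} (π : Equiv.Perm (Fin n)) (S : Finset (Fin n)) {t w B : ℕ}
    (ht : 0 < t) (hB : 2 ≤ B) (hBw : B < w) (hBn : B < n)
    (hsize : (shortcutBase n t + S.card) * B ≤ 2 ^ w) (hn : 2 * n ≤ 2 ^ B)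
    (hS : shortcutBase n t + S.card < 2 ^ B)
    (hit : ∀ x, ∃ k < t, (π ^ k) x ∈ S ∨ (π ^ (k + 1)) x = x) :
    ∃ X < 2 ^ ((shortcutBase n t + S.card) * B), Represents π S t w X B := by
  classical
  have : Nonempty (Fin n) := ⟨⟨0, by omega⟩⟩
  set b := shortcutBase n t with hb
  have hb' : b = n + n / t + 2 := rfl
  have hb1 : n + 2 ≤ b := by simp [b, shortcutBase]
  -- `F j` is the content of field $j+1$, since field $0$ is the header: first images with marks,
  -- then the directory, then the shortcuts ordered by rank.
  let F : ℕ → ℕ := fun j =>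
    if hj : j < n then 2 * (π ⟨j, hj⟩ : ℕ) + if ⟨j, hj⟩ ∈ S then 1 else 0
    else if j ≤ n + n / t then b + rank S ((j - n) * t)
    else ((π ^ t)⁻¹ (Function.invFunOn (fun y : Fin n => rank S y) (S : Set (Fin n))
      (j + 1 - b)) : Fin n)
  obtain ⟨L, hL⟩ : ∃ L, b + S.card = L + 1 := ⟨b + S.card - 1, by omega⟩
  obtain ⟨X, hX, hF⟩ := exists_fields B L F (by
    intro j _
    simp only [F]
    split_ifs with h1 h2 h3
    · have := (π ⟨j, h1⟩).isLt
      omega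
    · have := (π ⟨j, h1⟩).isLt
      omega
    · have := rank_le_card S ((j - n) * t)
      omega
    · refine lt_of_lt_of_le (Fin.isLt _) ?_
      omega)
  obtain ⟨h, hh, hmod⟩ := exists_add_mod_eq hBn (2 ^ B * (X % 2 ^ (w - B)))
  have hhB : h < 2 ^ B := by omega
  refine ⟨h + 2 ^ B * X, hL ▸ add_two_pow_mul_lt hhB hX, ht, hB, hBw, ?_, hsize, ?_, ?_, ?_, hit⟩
  · rw [← Nat.add_sub_cancel' hBw.le, pow_add, Nat.mod_mul, Nat.add_mul_mod_self_left,
      Nat.mod_eq_of_lt hhB, Nat.add_mul_div_left _ _ (by positivity), Nat.div_eq_of_lt hhB,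
      zero_add, hmod]
  · intro y
    rw [field_succ _ _ _ _ hhB, hF _ (by have := y.isLt; omega)]
    simp [F]
  · intro r hr
    rw [field_succ _ _ _ _ hhB, hF _ (by omega)]
    have h2 : r + n ≤ n + n / t := by omega
    simp [F, h2, hb]
  · intro y hy
    have h0 := rank_lt_card S hy
    obtain ⟨j, hj⟩ : ∃ j, b + rank S y = j + 1 := ⟨b + rank S y - 1, by omega⟩
    rw [hj, field_succ _ _ _ _ hhB, hF _ (by omega)]
    have h1 : ¬ j < n := by omega
    have h2 : ¬ j ≤ n + n / t := by omega
    have h3 : j + 1 - b = rank S y := by omega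
    simp only [F, h1, h2, h3, dite_false, if_false]
    rw [(rank_injOn S).leftInvOn_invFunOn hy]

/-! ### Estimates for factorials, logarithms and word lengths. -/

/-- The factor $2$ pays for rounding $\lg n^n$ down in `factorial_le_two_pow_log`. -/
theorem two_mul_factorial_le (n : ℕ) (hn : 2 ≤ n) : 2 * n ! ≤ n ^ n := by
  obtain ⟨m, rfl⟩ : ∃ m, n = m + 2 := ⟨n - 2, by omega⟩
  have key : ∀ m, 2 * (m + 1)! ≤ (m + 2) ^ (m + 1) := by
    intro m
    induction m with
    | zero => simp
    | succ m ih =>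
      calc 2 * (m + 1 + 1)! = (m + 2) * (2 * (m + 1)!) := by rw [Nat.factorial_succ (m + 1)]; ring
        _ ≤ (m + 2) * (m + 2) ^ (m + 1) := Nat.mul_le_mul_left _ ih
        _ = (m + 2) ^ (m + 1 + 1) := by ring
        _ ≤ (m + 1 + 2) ^ (m + 1 + 1) := Nat.pow_le_pow_left (by omega) _
  calc 2 * (m + 2)! = (m + 2) * (2 * (m + 1)!) := by rw [Nat.factorial_succ (m + 1)]; ring
    _ ≤ (m + 2) * (m + 2) ^ (m + 1) := Nat.mul_le_mul_left _ (key m)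
    _ = (m + 2) ^ (m + 2) := by ring

theorem factorial_le_two_pow_log (n : ℕ) : n ! ≤ 2 ^ Nat.log 2 (n ^ n) := by
  rcases Nat.lt_or_ge n 2 with hn | hn
  · interval_cases n <;> simp
  · have h1 := two_mul_factorial_le n hn
    have h2 := Nat.lt_pow_succ_log_self (b := 2) (by norm_num) (n ^ n)
    rw [pow_succ] at h2
    omega

theorem log_pow_self_le (n : ℕ) : (Nat.log 2 (n ^ n) : ℝ) ≤ n * Real.logb 2 n := by
  rcases Nat.eq_zero_or_pos n with rfl | hn
  · simp
  rw [← Real.logb_pow, ← Nat.cast_pow]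
  rw [Real.le_logb_iff_rpow_le (by norm_num) (by positivity), Real.rpow_natCast]
  exact_mod_cast Nat.pow_log_le_self 2 (pow_pos hn n).ne'

/-- Take logarithms in $n^n/n!\le e^n$; the constant $2$ comes from $\ln2>1/2$. -/
theorem mul_logb_le_logb_factorial (n : ℕ) (hn : 0 < n) :
    (n : ℝ) * Real.logb 2 n ≤ Real.logb 2 (n ! : ℝ) + 2 * n := by
  have hn' : (0 : ℝ) < n := by exact_mod_cast hn
  have h1 := Real.pow_div_factorial_le_exp (n : ℝ) hn'.le n
  have hf : (0 : ℝ) < (n ! : ℝ) := by exact_mod_cast Nat.factorial_pos n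
  have h2 := Real.log_le_log (by positivity) h1
  rw [Real.log_exp, Real.log_div (by positivity) hf.ne', Real.log_pow] at h2
  have h3 : (1 : ℝ) / 2 < Real.log 2 := by have := Real.log_two_gt_d9; linarith
  have h4 : (0 : ℝ) < Real.log 2 := by linarith
  simp only [Real.logb]
  rw [← mul_div_assoc, div_le_iff₀ h4, add_mul, div_mul_cancel₀ _ h4.ne']
  nlinarith

theorem lt_two_pow_of_logb_le {a : ℝ} (ha : 1 < a) {n w : ℕ} (hw : 1 ≤ w)
    (h : a * Real.logb 2 n ≤ w) : n < 2 ^ w := by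
  rcases Nat.lt_or_ge n 2 with hn | hn
  · exact hn.trans_le (by simpa using Nat.pow_le_pow_right (n := 2) (by norm_num) hw)
  · have hn' : (1 : ℝ) < n := by exact_mod_cast hn
    have h0 : 0 < Real.logb 2 n := Real.logb_pos (by norm_num) hn'
    have h1 : Real.logb 2 n < w := by nlinarith
    rw [Real.logb_lt_iff_lt_rpow (by norm_num) (by linarith), Real.rpow_natCast] at h1
    exact_mod_cast h1

theorem logb_le_self (n : ℕ) : Real.logb 2 n ≤ n := by
  rcases Nat.eq_zero_or_pos n with rfl | hn
  · simp
  · rw [Real.logb_le_iff_le_rpow (by norm_num) (by exact_mod_cast hn), Real.rpow_natCast]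
    exact_mod_cast Nat.lt_two_pow_self.le

theorem size_le_logb_add_one {n : ℕ} (hn : 0 < n) : (n.size : ℝ) ≤ Real.logb 2 n + 1 := by
  have h0 : 0 < n.size := Nat.size_pos.2 hn
  have h1 : 2 ^ (n.size - 1) ≤ n := Nat.lt_size.1 (by omega)
  have h2 : ((n.size - 1 : ℕ) : ℝ) ≤ Real.logb 2 n := by
    rw [Real.le_logb_iff_rpow_le (by norm_num) (by exact_mod_cast hn), Real.rpow_natCast]
    exact_mod_cast h1
  rw [Nat.cast_sub h0] at h2
  push_cast at h2
  linarith

theorem le_logb_of_two_pow_le {M n : ℕ} (h : 2 ^ M ≤ n) : (M : ℝ) ≤ Real.logb 2 n := by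
  have hn : 0 < n := lt_of_lt_of_le (by positivity) h
  rw [Real.le_logb_iff_rpow_le (by norm_num) (by exact_mod_cast hn), Real.rpow_natCast]
  exact_mod_cast h

theorem exists_mul_logb_le_two_pow {a : ℝ} (ha : 1 < a) : ∃ M : ℕ, ∀ n w : ℕ, 2 ^ M ≤ n →
    a * Real.logb 2 n ≤ w → 12 * (n * Real.logb 2 n) ≤ (2 : ℝ) ^ w := by
  have h2 : 0 < Real.log 2 := Real.log_pos (by norm_num)
  set c := (a - 1) * Real.log 2 with hc
  have hc0 : 0 < c := mul_pos (by linarith) h2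
  -- With $l=\lg n$, $n^{a-1}=e^{cl}\ge(cl)^2/2\ge12l$ as soon as $l\ge24/c^2$.
  obtain ⟨M, hM⟩ := exists_nat_ge (24 / c ^ 2)
  refine ⟨M, fun n w hn hw => ?_⟩
  have hl := hM.trans (le_logb_of_two_pow_le hn)
  set l := Real.logb 2 n with hl'
  have hnpos : (0 : ℝ) < n := by
    exact_mod_cast lt_of_lt_of_le (by positivity) hn
  have hl0 : 0 ≤ l := le_trans (by positivity) hl
  have h1 : 12 * l ≤ Real.exp (c * l) := by
    have := Real.quadratic_le_exp_of_nonneg (x := c * l) (by positivity)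
    rw [div_le_iff₀ (by positivity)] at hl
    nlinarith [mul_nonneg hc0.le hl0]
  have h3 : Real.exp (c * l) * n = (2 : ℝ) ^ (a * l) := by
    have : (n : ℝ) = Real.exp (Real.log 2 * l) := by
      rw [hl', mul_comm, Real.logb, div_mul_cancel₀ _ h2.ne', Real.exp_log hnpos]
    rw [this, ← Real.exp_add, Real.rpow_def_of_pos (by norm_num), hc]
    congr 1
    ring
  calc 12 * (n * l) = (12 * l) * n := by ring
    _ ≤ Real.exp (c * l) * n := by gcongr
    _ = (2 : ℝ) ^ (a * l) := h3
    _ ≤ (2 : ℝ) ^ (w : ℝ) := Real.rpow_le_rpow_of_exponent_le (by norm_num) hw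
    _ = (2 : ℝ) ^ w := Real.rpow_natCast _ _

theorem add_five_lt_two_pow (k : ℕ) (hk : 4 ≤ k) : k + 5 < 2 ^ k := by
  induction k, hk using Nat.le_induction with
  | base => norm_num
  | succ k _ ih => rw [pow_succ]; omega

theorem size_add_four_lt {n : ℕ} (hn : 16 ≤ n) : n.size + 4 < n := by
  have h0 : 4 < n.size := Nat.lt_size.2 (by simpa using hn)
  have h1 : 2 ^ (n.size - 1) ≤ n := Nat.lt_size.1 (by omega)
  have h2 := add_five_lt_two_pow (n.size - 1) (by omega)
  omega

/-! ### The representation for large $n$. -/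

/-- For large `n` there is a representation, and the number of its bits is as claimed. -/
theorem exists_represents_of_large {a : ℝ} (ha : 1 < a) : ∃ M : ℕ, ∀ n t w : ℕ, 2 ^ M ≤ n →
    1 ≤ t → a * Real.logb 2 n ≤ w → ∀ π : Equiv.Perm (Fin n), ∃ (s : ℕ) (D : BitVec s) (B : ℕ)
      (S : Finset (Fin n)), Represents π S t w D.toNat B ∧
        (s : ℝ) ≤ (n + 3 * (n / t) + 2) * (Real.logb 2 n + 5) := by
  obtain ⟨M₁, hM₁⟩ := exists_mul_logb_le_two_pow ha
  obtain ⟨M₂, hM₂⟩ := exists_nat_gt (5 / (a - 1))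
  -- `M₁` makes bit positions fit into a word, `M₂` makes $\lg n+5<w$, and $5$ gives $n\ge32$ and
  -- $\lg n\ge5$.
  refine ⟨M₁ + M₂ + 5, fun n t w hn ht hw π => ?_⟩
  have hpow (m : ℕ) (hm : m ≤ M₁ + M₂ + 5) : 2 ^ m ≤ n :=
    (Nat.pow_le_pow_right (by norm_num) hm).trans hn
  have hn16 : 32 ≤ n := hpow 5 (by omega)
  have hn1 : 0 < n := by omega
  have hbound := hM₁ n w (hpow M₁ (by omega)) hw
  have hl₂ := le_logb_of_two_pow_le (hpow M₂ (by omega))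
  have hl₅ := le_logb_of_two_pow_le (hpow 5 (by omega))
  have hsize := size_le_logb_add_one hn1
  set l := Real.logb 2 n with hl
  push_cast at hl₅
  obtain ⟨S, hScard, hit⟩ := exists_hitting_set π ht
  have htR : (0 : ℝ) < t := by exact_mod_cast ht
  have htR1 : (1 : ℝ) ≤ t := by exact_mod_cast ht
  have hnR : (32 : ℝ) ≤ n := by exact_mod_cast hn16
  have hSR : (S.card : ℝ) ≤ 2 * (n / t) := by
    rw [← mul_div_assoc, le_div_iff₀ htR]
    exact_mod_cast hScard
  have hLR : ((shortcutBase n t + S.card : ℕ) : ℝ) ≤ n + 3 * (n / t) + 2 := by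
    have : ((n / t : ℕ) : ℝ) ≤ n / t := Nat.cast_div_le
    simp only [shortcutBase]
    push_cast
    linarith
  have hBR : ((n.size + 4 : ℕ) : ℝ) ≤ l + 5 := by push_cast; linarith
  have hprod : (((shortcutBase n t + S.card) * (n.size + 4) : ℕ) : ℝ) ≤
      (n + 3 * (n / t) + 2) * (l + 5) := by
    rw [Nat.cast_mul]
    exact mul_le_mul hLR hBR (by positivity) (by positivity)
  have hnt : (n : ℝ) / t ≤ n := div_le_self (by linarith) htR1
  have hBw : n.size + 4 < w := by
    have : l + 5 < w := by
      have := hM₂.trans_le hl₂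
      rw [div_lt_iff₀ (by linarith)] at this
      nlinarith
    exact_mod_cast hBR.trans_lt this
  have hL6 : shortcutBase n t + S.card ≤ 6 * n := by
    have : ((shortcutBase n t + S.card : ℕ) : ℝ) ≤ ((6 * n : ℕ) : ℝ) := by
      push_cast at hLR ⊢
      linarith
    exact_mod_cast this
  -- The field width $B$ is `n.size + 4`: it must hold marked images below $2n$ and field numbers up
  -- to $6n$.
  have hnB : 16 * n < 2 ^ (n.size + 4) := by
    have := Nat.lt_size_self n
    rw [pow_add]
    omega
  have hfit : (shortcutBase n t + S.card) * (n.size + 4) ≤ 2 ^ w := by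
    have : (((shortcutBase n t + S.card) * (n.size + 4) : ℕ) : ℝ) ≤ ((2 ^ w : ℕ) : ℝ) := by
      refine hprod.trans (le_trans ?_ (le_of_le_of_eq hbound (by push_cast; rfl)))
      calc (n + 3 * (n / t) + 2) * (l + 5) ≤ (6 * n) * (2 * l) := by gcongr <;> linarith
        _ = 12 * (n * l) := by ring
    exact_mod_cast this
  obtain ⟨X, hX, hR⟩ := exists_represents π S (w := w) (B := n.size + 4) ht (by omega) hBw
    (size_add_four_lt (by omega)) hfit (by omega) (by omega) hit
  refine ⟨_, BitVec.ofNat _ X, n.size + 4, S, ?_, hprod⟩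
  rwa [BitVec.toNat_ofNat, Nat.mod_eq_of_lt hX]

/-! ### Codes of permutations for small $n$. -/

/-- A numbering of the permutations. -/
noncomputable def permEquiv (n : ℕ) : Equiv.Perm (Fin n) ≃ Fin (n !) :=
  Fintype.equivFinOfCardEq (by simp [Fintype.card_perm])

/-- The image of `x` under the permutation number `v`. -/
noncomputable def imageOfCode (n x v : ℕ) : ℕ :=
  if h : v < n ! ∧ x < n then (permEquiv n).symm ⟨v, h.1⟩ ⟨x, h.2⟩ else 0

/-- The preimage of `x` under the permutation number `v`. -/
noncomputable def preimageOfCode (n x v : ℕ) : ℕ :=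
  if h : v < n ! ∧ x < n then ((permEquiv n).symm ⟨v, h.1⟩)⁻¹ ⟨x, h.2⟩ else 0

/-- The code of a permutation as a string of bits. -/
noncomputable def code {n : ℕ} (π : Equiv.Perm (Fin n)) : BitVec (Nat.log 2 (n ^ n)) :=
  BitVec.ofNat _ (permEquiv n π)

theorem toNat_code {n : ℕ} (π : Equiv.Perm (Fin n)) : (code π).toNat = permEquiv n π := by
  rw [code, BitVec.toNat_ofNat]
  exact Nat.mod_eq_of_lt ((permEquiv n π).isLt.trans_le (factorial_le_two_pow_log n))

theorem imageOfCode_code {n : ℕ} (π : Equiv.Perm (Fin n)) (x : Fin n) :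
    imageOfCode n x (code π).toNat = π x := by
  simp [imageOfCode, toNat_code]

theorem preimageOfCode_code {n : ℕ} (π : Equiv.Perm (Fin n)) (x : Fin n) :
    preimageOfCode n x (code π).toNat = (π⁻¹ x : Fin n) := by
  simp [preimageOfCode, toNat_code]

theorem Computes.mono {s w : ℕ} {D : BitVec s} {P : Program} {inputs : List ℕ} {y T T' : ℕ}
    (h : Computes w D P inputs y T) (hT : T ≤ T') : Computes w D P inputs y T' := by
  obtain ⟨k, hk, h⟩ := h
  exact ⟨k, hk.trans hT, h⟩

/-- The number of steps that suffices for table lookup with `n < N`. -/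
def tableCost (N : ℕ) : ℕ := 4 + 10 * Nat.log 2 (N ^ N) + 3 * N + 3 * N

theorem computes_table {g : ℕ → ℕ → ℕ → ℕ} {N n w : ℕ} {dflt : Stmt} {l : List ℕ} (hw : 0 < w)
    (hnw : n < 2 ^ w) (hn : n < N) (x : Fin n) (D : BitVec (Nat.log 2 (n ^ n)))
    (hg : g n x D.toNat < n) :
    Computes w D ((tableStmt g N dflt).compile 0) ((x : ℕ) :: n :: w :: l) (g n x D.toNat)
      (tableCost N) := by
  refine Ev.computes (Ev.tableStmt hw hn x.isLt hnw ?_ ?_ ?_ hg)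
  · simp [init, Nat.mod_eq_of_lt (x.isLt.trans hnw)]
  · simp [init, Nat.mod_eq_of_lt hnw]
  · simp [init, Nat.mod_eq_of_lt Nat.lt_two_pow_self]

theorem computes_dflt {g : ℕ → ℕ → ℕ → ℕ} {N n w s k y : ℕ} {dflt : Stmt} {l : List ℕ}
    (hnw : n < 2 ^ w) (hn : N ≤ n) (x : Fin n) (D : BitVec s)
    (h : ∀ ρ : Regs w, (ρ 0).toNat = x → (ρ 1).toNat = n → (ρ 2).toNat = w →
      (ρ 3).toNat = l.getD 0 0 % 2 ^ w → Ev D dflt ρ k fun ρ' => (ρ' 0).toNat = y) :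
    Computes w D ((tableStmt g N dflt).compile 0) ((x : ℕ) :: n :: w :: l) y (k + 3 * N) := by
  refine Ev.computes (Ev.switch_of_le (v := n) (by norm_num) ?_ 0 N (by omega)
    fun ρ hρ => h ρ ?_ ?_ ?_ ?_)
  · simp [init, Nat.mod_eq_of_lt hnw]
  · simp [hρ, init, Nat.mod_eq_of_lt (x.isLt.trans hnw)]
  · simp [hρ, init, Nat.mod_eq_of_lt hnw]
  · simp [hρ, init, Nat.mod_eq_of_lt Nat.lt_two_pow_self]
  · simp [hρ, init]

/-! ### The two main statements. -/

theorem exists_programs_of_parameter (a : ℝ) (ha : 1 < a) : ∃ (fwd inv : WordRAM.Program) (C : ℕ),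
    ∀ n t w : ℕ, 1 ≤ t → (t : ℝ) ≤ Real.logb 2 n → a * Real.logb 2 n ≤ w →
      ∀ π : Equiv.Perm (Fin n), ∃ (s : ℕ) (D : BitVec s),
        (s : ℝ) ≤ (⌈Real.logb 2 (n ! : ℝ)⌉₊ : ℝ) + C * ((n : ℝ) / t * Real.logb 2 n) ∧
        ∀ x : Fin n,
          WordRAM.Computes w D fwd [(x : ℕ), n, w, t] (π x : ℕ) C ∧
          WordRAM.Computes w D inv [(x : ℕ), n, w, t] (π⁻¹ x : ℕ) (C * t) := by
  obtain ⟨M, hM⟩ := exists_represents_of_large ha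
  set N := 2 ^ M with hN
  refine ⟨(tableStmt imageOfCode N fwdStmt).compile 0,
    (tableStmt preimageOfCode N invStmt).compile 0, tableCost N + 3 * N + 200,
    fun n t w ht htl hw π => ?_⟩
  have htR : (1 : ℝ) ≤ t := by exact_mod_cast ht
  have hln := logb_le_self n
  have hnR : (1 : ℝ) ≤ n := by linarith
  have hw1 : 1 ≤ w := by
    have : (0 : ℝ) < w := by nlinarith
    exact_mod_cast this
  have hnw := lt_two_pow_of_logb_le ha hw1 hw
  have htn : t ≤ n := by
    have : (t : ℝ) ≤ n := htl.trans hln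
    exact_mod_cast this
  set l := Real.logb 2 n with hl
  have hY : n * l = t * (n / t * l) := by field_simp
  have hl0 : 0 ≤ l := by linarith
  have hY0 : 0 ≤ n / t * l := by positivity
  have hceil := Nat.le_ceil (Real.logb 2 (n ! : ℝ))
  rcases Nat.lt_or_ge n N with hn | hn
  · refine ⟨_, code π, ?_, fun x => ⟨?_, ?_⟩⟩
    -- For small $n$ the error term alone pays for everything: $n\lg n=t\cdot(n/t)\lg n$ and $t\le
    -- n<N\le C$.
    · refine (log_pow_self_le n).trans ?_
      rw [← hl, hY]
      have h1 : (t : ℝ) ≤ (tableCost N + 3 * N + 200 : ℕ) := by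
        exact_mod_cast (show t ≤ tableCost N + 3 * N + 200 by omega)
      have h2 := mul_le_mul_of_nonneg_right h1 hY0
      have h3 : (0 : ℝ) ≤ (⌈Real.logb 2 (n ! : ℝ)⌉₊ : ℝ) := Nat.cast_nonneg _
      linarith
    · have h := computes_table (g := imageOfCode) (dflt := fwdStmt) (l := [t]) hw1 hnw hn x
        (code π) (by rw [imageOfCode_code]; exact Fin.isLt _)
      rw [imageOfCode_code] at h
      exact h.mono (by omega)
    · have h := computes_table (g := preimageOfCode) (dflt := invStmt) (l := [t]) hw1 hnw hn x
        (code π) (by rw [preimageOfCode_code]; exact Fin.isLt _)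
      rw [preimageOfCode_code] at h
      exact h.mono (by nlinarith)
  · obtain ⟨s, D, B, S, hR, hs⟩ := hM n t w hn ht hw π
    have htw : t % 2 ^ w = t := Nat.mod_eq_of_lt (by omega)
    refine ⟨s, D, hs.trans ?_, fun x => ⟨?_, ?_⟩⟩
    · have h1 := mul_logb_le_logb_factorial n (by exact_mod_cast (show (0 : ℝ) < n by linarith))
      rw [← hl] at h1 ⊢
      have h2 : (n : ℝ) ≤ n / t * l := by
        rw [div_mul_eq_mul_div, le_div_iff₀ (by linarith)]
        gcongr
      have h3 : (n : ℝ) / t ≤ n := div_le_self (by linarith) htR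
      have h4 : (200 : ℝ) ≤ (tableCost N + 3 * N + 200 : ℕ) := by
        exact_mod_cast Nat.le_add_left 200 _
      have h5 := mul_le_mul_of_nonneg_right h4 hY0
      nlinarith
    · exact (computes_dflt hnw hn x D fun ρ h0 h1 h2 h3 =>
        hR.evFwd h0 h1 h2 (by simpa [htw] using h3)).mono (by omega)
    · exact (computes_dflt hnw hn x D fun ρ h0 h1 h2 h3 =>
        hR.evInv h0 h1 h2 (by simpa [htw] using h3)).mono (by nlinarith)

theorem exists_programs_of_eps (a : ℝ) (ha : 1 < a) (ε : ℝ) (hε : 0 < ε) :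
    ∃ (fwd inv : WordRAM.Program) (C : ℕ),
      ∀ n w : ℕ, 1 ≤ w → a * Real.logb 2 n ≤ w →
        ∀ π : Equiv.Perm (Fin n), ∃ (s : ℕ) (D : BitVec s),
          (s : ℝ) ≤ (1 + ε) * n * Real.logb 2 n ∧
          ∀ x : Fin n,
            WordRAM.Computes w D fwd [(x : ℕ), n, w] (π x : ℕ) C ∧
            WordRAM.Computes w D inv [(x : ℕ), n, w] (π⁻¹ x : ℕ) C := by
  obtain ⟨M, hM⟩ := exists_represents_of_large ha
  -- With $l=\lg n$, the space is at most $(n+3n/t+2)(l+5)\le nl+3(n/t)l+32n$. The choice of `t`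
  -- makes the second term at most $\frac\varepsilon4nl$, and that of `K` makes the third at most
  -- $\frac\varepsilon2nl$.
  obtain ⟨t, ht⟩ := exists_nat_gt (12 / ε)
  obtain ⟨K, hK⟩ := exists_nat_gt (64 / ε)
  -- Including `t` in the exponent gives $t<2^t\le n<2^w$ in the large case, so the literal `t`
  -- survives reduction modulo $2^w$.
  set N := 2 ^ (M + t + K) with hN
  refine ⟨(tableStmt imageOfCode N (.seq (.block [.const 3 t]) fwdStmt)).compile 0,
    (tableStmt preimageOfCode N (.seq (.block [.const 3 t]) invStmt)).compile 0,
    tableCost N + 3 * N + 200 * t + 200, fun n w hw1 hw π => ?_⟩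
  have hnw := lt_two_pow_of_logb_le ha hw1 hw
  rcases Nat.lt_or_ge n N with hn | hn
  · refine ⟨_, code π, ?_, fun x => ⟨?_, ?_⟩⟩
    · refine (log_pow_self_le n).trans ?_
      rw [mul_assoc]
      have h0 : (0 : ℝ) ≤ n * Real.logb 2 n := by
        rcases Nat.eq_zero_or_pos n with rfl | h
        · simp
        · exact mul_nonneg (Nat.cast_nonneg n)
            (Real.logb_nonneg (by norm_num) (by exact_mod_cast h))
      nlinarith
    · have h := computes_table (g := imageOfCode) (dflt := .seq (.block [.const 3 t]) fwdStmt)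
        (l := []) hw1 hnw hn x (code π) (by rw [imageOfCode_code]; exact Fin.isLt _)
      rw [imageOfCode_code] at h
      exact h.mono (by omega)
    · have h := computes_table (g := preimageOfCode) (dflt := .seq (.block [.const 3 t]) invStmt)
        (l := []) hw1 hnw hn x (code π) (by rw [preimageOfCode_code]; exact Fin.isLt _)
      rw [preimageOfCode_code] at h
      exact h.mono (by omega)
  · have hpow (m : ℕ) (hm : m ≤ M + t + K) : 2 ^ m ≤ n :=
      (Nat.pow_le_pow_right (by norm_num) hm).trans hn
    have htR : (0 : ℝ) < t := lt_trans (by positivity) ht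
    have ht0 : 0 < t := by exact_mod_cast htR
    obtain ⟨s, D, B, S, hR, hs⟩ := hM n t w (hpow M (by omega)) ht0 hw π
    have htw : t % 2 ^ w = t :=
      Nat.mod_eq_of_lt ((Nat.lt_two_pow_self.trans_le (hpow t (by omega))).trans hnw)
    have hset (ρ : Regs w) (q : ℕ) (hq : q ≠ 3) :
        List.foldl (Basic.exec D) ρ [.const 3 t] q = ρ q := by
      simp [Basic.exec, hq]
    have hset3 (ρ : Regs w) : (List.foldl (Basic.exec D) ρ [.const 3 t] 3).toNat = t := by
      simp [Basic.exec, htw]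
    refine ⟨s, D, hs.trans ?_, fun x => ⟨?_, ?_⟩⟩
    · have hl := hK.trans_le (le_logb_of_two_pow_le (hpow K (by omega)))
      have hln := logb_le_self n
      have hn1 : (1 : ℝ) ≤ n := by
        exact_mod_cast (Nat.one_le_two_pow (n := M)).trans (hpow M (by omega))
      have ht1 : (1 : ℝ) ≤ t := by exact_mod_cast ht0
      set l := Real.logb 2 n
      have hl0 : 0 < l := lt_trans (by positivity) hl
      have h3 : (n : ℝ) / t ≤ n := div_le_self (by linarith) ht1
      have h4 : (n : ℝ) / t * l ≤ ε / 12 * (n * l) := by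
        rw [div_mul_eq_mul_div, div_le_iff₀ htR]
        rw [div_lt_iff₀ hε] at ht
        have : 0 ≤ n * l := by positivity
        nlinarith
      have h5 : 64 * (n : ℝ) ≤ ε * (n * l) := by
        rw [div_lt_iff₀ hε] at hl
        nlinarith
      nlinarith
    · exact (computes_dflt hnw hn x D fun ρ h0 h1 h2 _ => Ev.seq (Ev.block
        (hR.evFwd (by rw [hset _ _ (by norm_num), h0]) (by rw [hset _ _ (by norm_num), h1])
          (by rw [hset _ _ (by norm_num), h2]) (hset3 ρ)))).mono (by simp; omega)
    · exact (computes_dflt hnw hn x D fun ρ h0 h1 h2 _ => Ev.seq (Ev.block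
        (hR.evInv (by rw [hset _ _ (by norm_num), h0]) (by rw [hset _ _ (by norm_num), h1])
          (by rw [hset _ _ (by norm_num), h2]) (hset3 ρ)))).mono (by simp; omega)

end WordRAM

theorem mainTheorem8 :
    (∀ a : ℝ, 1 < a →
      ∃ (fwd inv : WordRAM.Program) (C : ℕ),
        ∀ n t w : ℕ, 1 ≤ t → (t : ℝ) ≤ Real.logb 2 n → a * Real.logb 2 n ≤ w →
          ∀ π : Equiv.Perm (Fin n), ∃ (s : ℕ) (D : BitVec s),
            (s : ℝ) ≤ (⌈Real.logb 2 (n ! : ℝ)⌉₊ : ℝ) + C * ((n : ℝ) / t * Real.logb 2 n) ∧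
            ∀ x : Fin n,
              WordRAM.Computes w D fwd [(x : ℕ), n, w, t] (π x : ℕ) C ∧
              WordRAM.Computes w D inv [(x : ℕ), n, w, t] (π⁻¹ x : ℕ) (C * t)) ∧
    (∀ a : ℝ, 1 < a → ∀ ε : ℝ, 0 < ε →
      ∃ (fwd inv : WordRAM.Program) (C : ℕ),
        ∀ n w : ℕ, 1 ≤ w → a * Real.logb 2 n ≤ w →
          ∀ π : Equiv.Perm (Fin n), ∃ (s : ℕ) (D : BitVec s),
            (s : ℝ) ≤ (1 + ε) * n * Real.logb 2 n ∧
            ∀ x : Fin n,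
              WordRAM.Computes w D fwd [(x : ℕ), n, w] (π x : ℕ) C ∧
              WordRAM.Computes w D inv [(x : ℕ), n, w] (π⁻¹ x : ℕ) C) :=
  ⟨WordRAM.exists_programs_of_parameter, WordRAM.exists_programs_of_eps⟩
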